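/- Let $d\ge 1$, let $\mathbb{B}^d$ be the open unit ball of $\mathbb{C}^d$, and let $d\tau(z)=(1-|z|^2)^{-(d+1)}\,dz$ be the hyperbolic volume measure on $\mathbb{B}^d$, where $dz$ is $2d$-dimensional Lebesgue measure. For $\lambda>0$ put $c_\lambda=\Gamma(\lambda)/(\pi^d\,\Gamma(\lambda-d))$, interpreted as $0$ if $\lambda$ is an integer with $\lambda\le d$, and for $\sigma>d$ put $d\mu_\sigma(z)=c_\sigma(1-|z|^2)^\sigma\,d\tau(z)$. Let $N=\sum_{j=1}^d z_j\,\partial/\partial z_j$. For $\lambda>0$ choose an integer $n\ge 0$ with $\lambda+2n>d$, and let $H(\mathbb{B}^d,\lambda)$ be the space of all holomorphic functions $f$ on $\mathbb{B}^d$ such that $N^kf\in L^2(\mathbb{B}^d,\mu_{\lambda+2n})$ for $0\le k\le n$, with the inner product (conjugate-linear in the first variable) $$\langle f,g\rangle_\lambda=\langle Af,Bg\rangle_{L^2(\mathbb{B}^d,\mu_{\lambda+2n})},\qquad A=\prod_{j=0}^{n-1}\Bigl(I+\frac{N}{\lambda+n+j}\Bigr),\quad B=\prod_{j=0}^{n-1}\Bigl(I+\frac{N}{\lambda+j}\Bigr).$$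 (This Hilbert space does not depend on the choice of $n$.) **Theorem.** Let $\lambda>0$ and $\phi\in L^1(\mathbb{B}^d,\tau)$. For any such choice of $n$, there is a unique Hilbert–Schmidt operator $T_\phi$ on $H(\mathbb{B}^d,\lambda)$ such that $$\langle f,T_\phi g\rangle_\lambda=c_\lambda\int_{\mathbb{B}^d}\overline{f(z)}\,\phi(z)\,g(z)\,(1-|z|^2)^\lambda\,d\tau(z)$$ for all bounded functions $f,g\in H(\mathbb{B}^d,\lambda)$; here the integrals converge absolutely. Its Hilbert–Schmidt norm satisfies $$\|T_\phi\|_{HS}\le |c_\lambda|\,\|\phi\|_{L^1(\mathbb{B}^d,\tau)}.$$ In particular, $T_\phi=0$ if $\lambda$ is an integer with $\lambda\le d$. -/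

import Mathlib

open MeasureTheory
open scoped ENNReal InnerProductSpace ComplexConjugate

noncomputable section

namespace Bergman

/-! ### The ball, the hyperbolic measure and the normalisation constants -/

/-- `ℂ^d` with its Euclidean norm. -/
abbrev Cd (d : ℕ) : Type := EuclideanSpace ℂ (Fin d)

/-- The open unit ball of `ℂ^d`. -/
def unitBall (d : ℕ) : Set (Cd d) := Metric.ball 0 1

/-- The hyperbolic volume measure `(1 - |z|²)^{-(d+1)} dz` on the unit ball, where `dz` is
`2d`-dimensional Lebesgue measure (as a measure on `ℂ^d` it vanishes outside the ball). -/
def hypMeasure (d : ℕ) : Measure (Cd d) :=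
  (volume.restrict (unitBall d)).withDensity
    fun z => ENNReal.ofReal ((1 - ‖z‖ ^ 2) ^ (-((d : ℝ) + 1)))

/-- `c_σ = Γ(σ) / (π^d Γ(σ - d))`. When `σ - d` is one of the poles `0, -1, -2, …` of `Γ`, the value
is `0`: there `Real.Gamma` is `0`, and so is the quotient; see `normConst_eq_zero`. -/
def normConst (d : ℕ) (σ : ℝ) : ℝ :=
  Real.Gamma σ / (Real.pi ^ d * Real.Gamma (σ - d))

theorem normConst_eq_zero (d : ℕ) (σ : ℝ) (k : ℕ) (h : σ - d = -(k : ℝ)) :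
    normConst d σ = 0 := by
  simp [normConst, h, Real.Gamma_neg_nat_eq_zero]

/-- The measure `dμ_σ(z) = c_σ (1 - |z|²)^σ dτ(z)`. It is used for `σ > d` only (when `c_σ > 0`). -/
def bergmanMeasure (d : ℕ) (σ : ℝ) : Measure (Cd d) :=
  (hypMeasure d).withDensity fun z => ENNReal.ofReal (normConst d σ * (1 - ‖z‖ ^ 2) ^ σ)

/-! ### Holomorphic functions on the ball and the number operator -/

/-- A holomorphic function on the unit ball is represented by its extension by `0` to `ℂ^d`. -/
def IsHol {d : ℕ} (f : Cd d → ℂ) : Prop :=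
  AnalyticOnNhd ℂ f (unitBall d) ∧ ∀ z ∉ unitBall d, f z = 0

/-- The number operator `N = ∑ j, z_j ∂/∂z_j` on the unit ball (extended by `0`). -/
def numberOp {d : ℕ} (f : Cd d → ℂ) : Cd d → ℂ :=
  (unitBall d).indicator fun z => ∑ j, z j * fderiv ℂ f z (EuclideanSpace.single j 1)

/-- The operator `I + N / a`. -/
def shiftOp {d : ℕ} (a : ℝ) (f : Cd d → ℂ) : Cd d → ℂ :=
  f + ((a : ℂ)⁻¹) • numberOp f

/-- The operator `(I + N / a) (I + N / (a + 1)) ⋯ (I + N / (a + m - 1))`. -/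
def shiftProd {d : ℕ} (a : ℝ) : ℕ → (Cd d → ℂ) → (Cd d → ℂ)
  | 0, f => f
  | m + 1, f => shiftProd a m (shiftOp (a + m) f)

/-! ### Elementary facts -/

theorem isOpen_unitBall (d : ℕ) : IsOpen (unitBall d) := Metric.isOpen_ball

theorem mem_unitBall {d : ℕ} {z : Cd d} : z ∈ unitBall d ↔ ‖z‖ < 1 := by
  simp [unitBall]

theorem numberOp_apply {d : ℕ} (f : Cd d → ℂ) {z : Cd d} (hz : z ∈ unitBall d) :
    numberOp f z = fderiv ℂ f z z := by
  rw [numberOp, Set.indicator_of_mem hz]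
  have h : z = ∑ j, z j • EuclideanSpace.single j (1 : ℂ) := by
    simpa using ((EuclideanSpace.basisFun (Fin d) ℂ).sum_repr z).symm
  conv_rhs => enter [2]; rw [h]
  simp only [map_sum, map_smul, smul_eq_mul]

theorem numberOp_of_notMem {d : ℕ} (f : Cd d → ℂ) {z : Cd d} (hz : z ∉ unitBall d) :
    numberOp f z = 0 := Set.indicator_of_notMem hz _

theorem IsHol.differentiableAt {d : ℕ} {f : Cd d → ℂ} (hf : IsHol f) {z : Cd d}
    (hz : z ∈ unitBall d) : DifferentiableAt ℂ f z := (hf.1 z hz).differentiableAt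

theorem IsHol.zero {d : ℕ} : IsHol (0 : Cd d → ℂ) :=
  ⟨analyticOnNhd_const, fun _ _ => rfl⟩

theorem IsHol.add {d : ℕ} {f g : Cd d → ℂ} (hf : IsHol f) (hg : IsHol g) : IsHol (f + g) :=
  ⟨hf.1.add hg.1, fun z hz => by simp [hf.2 z hz, hg.2 z hz]⟩

theorem IsHol.smul {d : ℕ} {f : Cd d → ℂ} (c : ℂ) (hf : IsHol f) : IsHol (c • f) :=
  ⟨hf.1.const_smul, fun z hz => by simp [hf.2 z hz]⟩

theorem IsHol.numberOp {d : ℕ} {f : Cd d → ℂ} (hf : IsHol f) : IsHol (numberOp f) := by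
  refine ⟨?_, fun z hz => numberOp_of_notMem f hz⟩
  have h1 : AnalyticOnNhd ℂ (fun z => fderiv ℂ f z z) (unitBall d) :=
    fun z hz => ((ContinuousLinearMap.apply ℂ ℂ (E := Cd d)).flip.analyticAt_bilinear
      (fderiv ℂ f z, z)).comp₂ (hf.1 z hz).fderiv analyticAt_id
  exact h1.congr (isOpen_unitBall d) fun z hz => (numberOp_apply f hz).symm

theorem IsHol.shiftOp {d : ℕ} {f : Cd d → ℂ} (a : ℝ) (hf : IsHol f) : IsHol (shiftOp a f) :=
  hf.add (hf.numberOp.smul _)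

theorem IsHol.shiftProd {d : ℕ} (a : ℝ) (m : ℕ) {f : Cd d → ℂ} (hf : IsHol f) :
    IsHol (shiftProd a m f) := by
  induction m generalizing f with
  | zero => exact hf
  | succ m ih => exact ih (hf.shiftOp _)

theorem IsHol.iterate {d : ℕ} (k : ℕ) {f : Cd d → ℂ} (hf : IsHol f) :
    IsHol (Bergman.numberOp^[k] f) := by
  induction k generalizing f with
  | zero => exact hf
  | succ k ih => exact ih hf.numberOp

theorem numberOp_add {d : ℕ} {f g : Cd d → ℂ} (hf : IsHol f) (hg : IsHol g) :
    numberOp (f + g) = numberOp f + numberOp g := by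
  funext z
  by_cases hz : z ∈ unitBall d
  · simp [numberOp_apply _ hz, fderiv_add (hf.differentiableAt hz) (hg.differentiableAt hz)]
  · simp [numberOp_of_notMem _ hz]

theorem numberOp_smul {d : ℕ} (c : ℂ) {f : Cd d → ℂ} (hf : IsHol f) :
    numberOp (c • f) = c • numberOp f := by
  funext z
  by_cases hz : z ∈ unitBall d
  · simp [numberOp_apply _ hz, fderiv_const_smul (hf.differentiableAt hz)]
  · simp [numberOp_of_notMem _ hz]

theorem iterate_add {d : ℕ} (k : ℕ) {f g : Cd d → ℂ} (hf : IsHol f) (hg : IsHol g) :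
    numberOp^[k] (f + g) = numberOp^[k] f + numberOp^[k] g := by
  induction k generalizing f g with
  | zero => rfl
  | succ k ih => simp only [Function.iterate_succ_apply, numberOp_add hf hg,
      ih hf.numberOp hg.numberOp]

theorem iterate_smul {d : ℕ} (k : ℕ) (c : ℂ) {f : Cd d → ℂ} (hf : IsHol f) :
    numberOp^[k] (c • f) = c • numberOp^[k] f := by
  induction k generalizing f with
  | zero => rfl
  | succ k ih => simp only [Function.iterate_succ_apply, numberOp_smul c hf, ih hf.numberOp]

theorem shiftOp_add {d : ℕ} (a : ℝ) {f g : Cd d → ℂ} (hf : IsHol f) (hg : IsHol g) :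
    shiftOp a (f + g) = shiftOp a f + shiftOp a g := by
  simp only [shiftOp, numberOp_add hf hg, smul_add]
  abel

theorem shiftOp_smul {d : ℕ} (a : ℝ) (c : ℂ) {f : Cd d → ℂ} (hf : IsHol f) :
    shiftOp a (c • f) = c • shiftOp a f := by
  simp only [shiftOp, numberOp_smul c hf, smul_add, smul_comm c]

theorem shiftProd_add {d : ℕ} (a : ℝ) (m : ℕ) {f g : Cd d → ℂ} (hf : IsHol f) (hg : IsHol g) :
    shiftProd a m (f + g) = shiftProd a m f + shiftProd a m g := by
  induction m generalizing f g with
  | zero => rfl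
  | succ m ih => simp only [shiftProd, shiftOp_add _ hf hg, ih (hf.shiftOp _) (hg.shiftOp _)]

theorem shiftProd_smul {d : ℕ} (a : ℝ) (m : ℕ) (c : ℂ) {f : Cd d → ℂ} (hf : IsHol f) :
    shiftProd a m (c • f) = c • shiftProd a m f := by
  induction m generalizing f with
  | zero => rfl
  | succ m ih => simp only [shiftProd, shiftOp_smul _ c hf, ih (hf.shiftOp _)]

/-! ### The generalized Bergman space as a vector space -/

/-- The vector space of all holomorphic `f` on the ball such that `N^k f` is square-integrable with
respect to `μ_{lam+2n}` for `0 ≤ k ≤ n`. -/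
def sobolevSubmodule (d : ℕ) (lam : ℝ) (n : ℕ) : Submodule ℂ (Cd d → ℂ) where
  carrier := {f | IsHol f ∧ ∀ k ≤ n, MemLp (numberOp^[k] f) 2 (bergmanMeasure d (lam + 2 * n))}
  add_mem' := by
    rintro f g ⟨hf, hf'⟩ ⟨hg, hg'⟩
    refine ⟨hf.add hg, fun k hk => ?_⟩
    rw [iterate_add k hf hg]
    exact (hf' k hk).add (hg' k hk)
  zero_mem' := by
    refine ⟨IsHol.zero, fun k _ => ?_⟩
    have h := iterate_smul k 0 (IsHol.zero (d := d))
    rw [zero_smul, zero_smul] at h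
    rw [h]
    exact MemLp.zero
  smul_mem' := by
    rintro c f ⟨hf, hf'⟩
    refine ⟨hf.smul c, fun k hk => ?_⟩
    rw [iterate_smul k c hf]
    exact (hf' k hk).const_smul c

theorem memLp_shiftProd {d : ℕ} {μ : Measure (Cd d)} (a : ℝ) (m : ℕ) {f : Cd d → ℂ}
    (hf : IsHol f) (h : ∀ k ≤ m, MemLp (numberOp^[k] f) 2 μ) :
    MemLp (shiftProd a m f) 2 μ := by
  induction m generalizing f with
  | zero => exact h 0 le_rfl
  | succ m ih =>
    refine ih (hf.shiftOp _) fun k hk => ?_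
    rw [shiftOp, iterate_add k hf (hf.numberOp.smul _), iterate_smul k _ hf.numberOp,
      ← Function.iterate_succ_apply]
    exact (h k (by omega)).add ((h (k + 1) (by omega)).const_smul _)

/-! ### Expansion along complex lines; positivity of the inner product -/

/-- `f (ζ z) = ∑ a_k ζ^k` along the complex line through `z`. -/
def Slice {d : ℕ} (f : Cd d → ℂ) (z : Cd d) (a : ℕ → ℂ) : Prop :=
  ∀ ζ : ℂ, ‖ζ • z‖ < 1 → HasSum (fun k => a k * ζ ^ k) (f (ζ • z))

theorem exists_radius {d : ℕ} {z : Cd d} {ζ : ℂ} (h : ‖ζ • z‖ < 1) :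
    ∃ r : ℝ, ‖ζ‖ < r ∧ ∀ w : ℂ, ‖w‖ ≤ r → ‖w • z‖ < 1 := by
  rw [norm_smul] at h
  have h0 : Filter.Tendsto (fun r : ℝ => r * ‖z‖) (nhdsWithin ‖ζ‖ (Set.Ioi ‖ζ‖))
      (nhds (‖ζ‖ * ‖z‖)) :=
    ((continuous_id.mul continuous_const).tendsto ‖ζ‖).mono_left nhdsWithin_le_nhds
  obtain ⟨r, hr, hr'⟩ := ((h0.eventually (gt_mem_nhds h)).and self_mem_nhdsWithin).exists
  refine ⟨r, hr', fun w hw => ?_⟩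
  rw [norm_smul]
  exact (mul_le_mul_of_nonneg_right hw (norm_nonneg z)).trans_lt hr

theorem hasDerivAt_slice {d : ℕ} {f : Cd d → ℂ} (hf : IsHol f) {z : Cd d} {ζ : ℂ}
    (h : ‖ζ • z‖ < 1) :
    HasDerivAt (fun w : ℂ => f (w • z)) (fderiv ℂ f (ζ • z) z) ζ := by
  have h1 : HasDerivAt (fun w : ℂ => w • z) ((1 : ℂ) • z) ζ := (hasDerivAt_id ζ).smul_const z
  rw [one_smul] at h1
  exact (hf.differentiableAt (mem_unitBall.2 h)).hasFDerivAt.comp_hasDerivAt ζ h1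

theorem IsHol.exists_slice {d : ℕ} {f : Cd d → ℂ} (hf : IsHol f) (z : Cd d) :
    ∃ a, Slice f z a := by
  refine ⟨fun k => ((k.factorial : ℂ))⁻¹ * iteratedDeriv k (fun w : ℂ => f (w • z)) 0,
    fun ζ h => ?_⟩
  obtain ⟨r, hr, hr'⟩ := exists_radius h
  have hd : DifferentiableOn ℂ (fun w : ℂ => f (w • z)) (Metric.ball 0 r) := fun w hw =>
    (hasDerivAt_slice hf (hr' w (by simpa using (Metric.mem_ball.1 hw).le))
      ).differentiableAt.differentiableWithinAt
  have := Complex.hasSum_taylorSeries_on_ball hd (z := ζ) (by simpa using hr)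
  refine this.congr_fun fun k => ?_
  simp only [sub_zero, smul_eq_mul]
  ring

theorem Slice.summable {d : ℕ} {f : Cd d → ℂ} {z : Cd d} {a : ℕ → ℂ} (h : Slice f z a)
    {r : ℝ} (hr0 : 0 ≤ r) (hr : ‖(r : ℂ) • z‖ < 1) : Summable fun k => ‖a k‖ * r ^ k := by
  have := (h r hr).summable.norm
  simpa [abs_of_nonneg hr0] using this

theorem Slice.numberOp {d : ℕ} {f : Cd d → ℂ} (hf : IsHol f) {z : Cd d} {a : ℕ → ℂ}
    (h : Slice f z a) : Slice (numberOp f) z fun k => (k : ℂ) * a k := by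
  intro ζ hζ
  obtain ⟨r, hr, hr'⟩ := exists_radius hζ
  have hr0 : 0 ≤ r := (norm_nonneg ζ).trans hr.le
  have hs := h.summable hr0 (hr' r (by simp [abs_of_nonneg hr0]))
  have key := Complex.hasSum_deriv_of_summable_norm (U := Metric.ball (0 : ℂ) r) (z := ζ)
    (F := fun k w => a k * w ^ k) hs (fun k => by fun_prop) Metric.isOpen_ball
    (fun k w hw => by
      rw [norm_mul, norm_pow]
      have : ‖w‖ ≤ r := by simpa using (Metric.mem_ball.1 hw).le
      gcongr) (by simpa using hr)
  have e : deriv (fun w : ℂ => ∑' k, a k * w ^ k) ζ = fderiv ℂ f (ζ • z) z := by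
    rw [← (hasDerivAt_slice hf hζ).deriv]
    apply Filter.EventuallyEq.deriv_eq
    filter_upwards [Metric.isOpen_ball.mem_nhds (show ζ ∈ Metric.ball (0 : ℂ) r by simpa using hr)]
      with w hw
    exact (h w (hr' w (by simpa using (Metric.mem_ball.1 hw).le))).tsum_eq
  rw [e] at key
  rw [numberOp_apply f (mem_unitBall.2 hζ), map_smul, smul_eq_mul]
  have key2 := key.mul_left ζ
  refine key2.congr_fun fun k => ?_
  rw [deriv_const_mul_field, deriv_pow_field]
  cases k with
  | zero => simp
  | succ k =>
    simp only [Nat.add_sub_cancel]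
    ring

/-- The eigenvalue of `shiftProd a m` on homogeneous functions of degree `k`. -/
def symb (a : ℝ) (m k : ℕ) : ℝ := ∏ j ∈ Finset.range m, (1 + k / (a + j))

theorem one_le_symb {a : ℝ} (ha : 0 < a) (m k : ℕ) : 1 ≤ symb a m k := by
  refine Finset.one_le_prod fun j _ => ?_
  have : 0 ≤ (k : ℝ) / (a + j) := by positivity
  linarith

theorem Slice.shiftProd {d : ℕ} (α : ℝ) (m : ℕ) {f : Cd d → ℂ} (hf : IsHol f) {z : Cd d}
    {a : ℕ → ℂ} (h : Slice f z a) :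
    Slice (shiftProd α m f) z fun k => (symb α m k : ℂ) * a k := by
  induction m generalizing f a with
  | zero => simpa [symb, Bergman.shiftProd] using h
  | succ m ih =>
    have h1 : Slice (Bergman.shiftOp (α + m) f) z fun k => (1 + (k : ℂ) / (α + m)) * a k := by
      intro ζ hζ
      have := (h ζ hζ).add ((h.numberOp hf ζ hζ).mul_left (((α + m : ℝ) : ℂ)⁻¹))
      refine this.congr_fun fun k => ?_
      push_cast
      ring
    have h2 := ih (hf.shiftOp _) h1
    simp only [Bergman.shiftProd]
    convert h2 using 1
    funext k
    rw [symb, Finset.prod_range_succ, ← symb]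
    push_cast
    ring

/-- The point `e^{iθ}` of the unit circle. -/
def expi (θ : ℝ) : ℂ := Complex.exp (θ * Complex.I)

theorem norm_expi (θ : ℝ) : ‖expi θ‖ = 1 := Complex.norm_exp_ofReal_mul_I θ

theorem continuous_expi : Continuous expi := by unfold expi; fun_prop

theorem integral_expi (j k : ℕ) :
    ∫ θ in (0 : ℝ)..(2 * Real.pi), conj (expi θ ^ j) * expi θ ^ k
      = if j = k then (2 * Real.pi : ℂ) else 0 := by
  have e : ∀ θ : ℝ, conj (expi θ ^ j) * expi θ ^ k
      = Complex.exp ((((k : ℂ) - j) * Complex.I) * θ) := by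
    intro θ
    rw [expi, map_pow, ← Complex.exp_conj, ← Complex.exp_nat_mul, ← Complex.exp_nat_mul,
      ← Complex.exp_add]
    congr 1
    simp
    ring
  simp_rw [e]
  split_ifs with hjk
  · simp [hjk]
  · have hne : ((k : ℂ) - j) * Complex.I ≠ 0 := by
      refine mul_ne_zero (sub_ne_zero.2 ?_) Complex.I_ne_zero
      exact_mod_cast Ne.symm hjk
    rw [integral_exp_mul_complex hne]
    have : Complex.exp (((k : ℂ) - j) * Complex.I * ((2 * Real.pi : ℝ) : ℂ)) = 1 := by
      rw [Complex.exp_eq_one_iff]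
      refine ⟨(k : ℤ) - j, ?_⟩
      push_cast
      ring
    rw [this]
    simp

theorem hasSum_parseval {F G : ℝ → ℂ} {a b : ℕ → ℂ} (hF : Continuous F)
    (ha : Summable fun k => ‖a k‖) (hb : Summable fun k => ‖b k‖)
    (hFa : ∀ θ, HasSum (fun k => a k * expi θ ^ k) (F θ))
    (hGb : ∀ θ, HasSum (fun k => b k * expi θ ^ k) (G θ)) :
    HasSum (fun k => 2 * Real.pi * (conj (a k) * b k))
      (∫ θ in (0 : ℝ)..(2 * Real.pi), conj (F θ) * G θ) := by
  have hce := continuous_expi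
  have step1 : ∀ k : ℕ, ∫ θ in (0 : ℝ)..(2 * Real.pi), conj (F θ) * expi θ ^ k
      = 2 * Real.pi * conj (a k) := by
    intro k
    have h := intervalIntegral.hasSum_integral_of_dominated_convergence
      (μ := volume) (a := 0) (b := 2 * Real.pi)
      (F := fun j θ => conj (a j) * (conj (expi θ ^ j) * expi θ ^ k))
      (f := fun θ => conj (F θ) * expi θ ^ k) (fun j _ => ‖a j‖)
      (fun j => Continuous.aestronglyMeasurable (by fun_prop))
      (fun j => .of_forall fun θ _ => by simp [norm_expi])
      (.of_forall fun θ _ => ha)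
      (by simp)
      (.of_forall fun θ _ => by
        have := ((Complex.hasSum_conj'.2 (by simpa using hFa θ)).mul_right (expi θ ^ k))
        simpa [mul_assoc] using this)
    simp only [intervalIntegral.integral_const_mul, integral_expi] at h
    rw [← h.tsum_eq, tsum_eq_single k (by intro j hj; simp [hj])]
    simp [mul_comm]
  have hbd : ∀ θ, ‖F θ‖ ≤ ∑' k, ‖a k‖ := fun θ => by
    rw [← (hFa θ).tsum_eq]
    have h2 : Summable fun k => ‖a k * expi θ ^ k‖ := by simpa [norm_expi] using ha
    simpa [norm_expi] using norm_tsum_le_tsum_norm h2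
  have h := intervalIntegral.hasSum_integral_of_dominated_convergence
      (μ := volume) (a := 0) (b := 2 * Real.pi)
      (F := fun k θ => b k * (conj (F θ) * expi θ ^ k))
      (f := fun θ => conj (F θ) * G θ) (fun k _ => ‖b k‖ * ∑' k, ‖a k‖)
      (fun j => Continuous.aestronglyMeasurable (by fun_prop))
      (fun j => .of_forall fun θ _ => by
        simp only [norm_mul, RCLike.norm_conj, norm_pow, norm_expi, one_pow, mul_one]
        gcongr
        exact hbd θ)
      (.of_forall fun θ _ => hb.mul_right _)
      (by simp)
      (.of_forall fun θ _ => by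
        have := (hGb θ).mul_left (conj (F θ))
        refine this.congr_fun fun k => ?_
        ring)
  simp only [intervalIntegral.integral_const_mul, step1] at h
  exact h.congr_fun fun k => by ring

/-! ### Invariance of the measures under rotations -/

theorem measurePreserving_withDensity {X : Type*} [MeasurableSpace X] {ν : Measure X} {g : X → X}
    (hg : MeasurePreserving g ν ν) {ρ : X → ℝ≥0∞} (hρ : Measurable ρ) (h : ∀ x, ρ (g x) = ρ x) :
    MeasurePreserving g (ν.withDensity ρ) (ν.withDensity ρ) := by
  refine ⟨hg.measurable, ?_⟩
  ext s hs
  rw [Measure.map_apply hg.measurable hs, withDensity_apply _ (hg.measurable hs),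
    withDensity_apply _ hs, ← hg.setLIntegral_comp_preimage hs hρ]
  simp_rw [h]

theorem measurePreserving_rotation (d : ℕ) (σ θ : ℝ) :
    MeasurePreserving (fun z : Cd d => expi θ • z) (bergmanMeasure d σ) (bergmanMeasure d σ) := by
  have h0 : MeasurePreserving (fun z : Cd d => expi θ • z) volume volume := by
    let u : ℂˣ := Units.mk0 (expi θ) (Complex.exp_ne_zero _)
    let L : Cd d ≃ₗ[ℝ] Cd d := (LinearEquiv.smulOfUnit u : Cd d ≃ₗ[ℂ] Cd d).restrictScalars ℝ
    exact LinearIsometryEquiv.measurePreserving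
      (⟨L, fun z => by
        change ‖expi θ • z‖ = ‖z‖
        rw [norm_smul, norm_expi, one_mul]⟩ : Cd d ≃ₗᵢ[ℝ] Cd d)
  have h1 := h0.restrict_preimage (isOpen_unitBall d).measurableSet
  have e : (fun z : Cd d => expi θ • z) ⁻¹' unitBall d = unitBall d := by
    ext z
    simp [mem_unitBall, norm_smul, norm_expi]
  rw [e] at h1
  refine measurePreserving_withDensity (measurePreserving_withDensity h1 ?_ ?_) ?_ ?_
  · fun_prop
  · simp [norm_smul, norm_expi]
  · fun_prop
  · simp [norm_smul, norm_expi]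

theorem continuousOn_of_isHol {d : ℕ} {f : Cd d → ℂ} (hf : IsHol f) :
    ContinuousOn f (unitBall d) := hf.1.continuousOn

theorem IsHol.measurable {d : ℕ} {f : Cd d → ℂ} (hf : IsHol f) : Measurable f := by
  classical
  have h : f = (unitBall d).piecewise f 0 := by
    funext z
    by_cases hz : z ∈ unitBall d
    · simp [hz]
    · simp [hz, hf.2 z hz]
  rw [h]
  exact (continuousOn_of_isHol hf).measurable_piecewise continuousOn_const
    (isOpen_unitBall d).measurableSet

theorem rotation_average {d : ℕ} {σ : ℝ} {k : Cd d → ℂ} (hm : Measurable k)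
    (hk : Integrable k (bergmanMeasure d σ)) :
    Integrable (fun z => ∫ θ in (0 : ℝ)..(2 * Real.pi), k (expi θ • z)) (bergmanMeasure d σ) ∧
      ∫ z, (∫ θ in (0 : ℝ)..(2 * Real.pi), k (expi θ • z)) ∂(bergmanMeasure d σ)
        = 2 * Real.pi * ∫ z, k z ∂(bergmanMeasure d σ) := by
  have hpi : (0 : ℝ) ≤ 2 * Real.pi := by positivity
  simp only [intervalIntegral.integral_of_le hpi]
  have : SFinite (bergmanMeasure d σ) := by unfold bergmanMeasure hypMeasure; infer_instance
  have hce := continuous_expi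
  have hmeas : Measurable (Function.uncurry fun (θ : ℝ) (z : Cd d) => k (expi θ • z)) := by
    refine hm.comp ?_
    exact (show Continuous fun p : ℝ × Cd d => expi p.1 • p.2 by fun_prop).measurable
  have hrot : ∀ θ, Integrable (fun z => k (expi θ • z)) (bergmanMeasure d σ) := fun θ =>
    (measurePreserving_rotation d σ θ).integrable_comp_of_integrable hk
  have hint : ∀ {E : Type} [NormedAddCommGroup E] [NormedSpace ℝ E] (h : Cd d → E),
      StronglyMeasurable h → ∀ θ, ∫ z, h (expi θ • z) ∂(bergmanMeasure d σ)
        = ∫ z, h z ∂(bergmanMeasure d σ) := fun h hh θ => by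
    have hp := measurePreserving_rotation d σ θ
    have h2 := integral_map (μ := bergmanMeasure d σ) hp.measurable.aemeasurable (f := h)
      hh.aestronglyMeasurable
    rw [hp.map_eq] at h2
    exact h2.symm
  have hprod : Integrable (Function.uncurry fun (θ : ℝ) (z : Cd d) => k (expi θ • z))
      ((volume.restrict (Set.Ioc 0 (2 * Real.pi))).prod (bergmanMeasure d σ)) := by
    rw [integrable_prod_iff hmeas.aestronglyMeasurable]
    refine ⟨.of_forall hrot, ?_⟩
    simp only [Function.uncurry_apply_pair]
    simp_rw [hint (fun z => ‖k z‖) hm.norm.stronglyMeasurable]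
    exact integrable_const _
  refine ⟨hprod.integral_prod_right, ?_⟩
  rw [← integral_integral_swap hprod]
  simp_rw [hint k hm.stronglyMeasurable]
  simp [Real.pi_pos.le]

/-- Circle average (up to the factor `2π`) of `conj (A f) * B g`. -/
def circ {d : ℕ} (α β : ℝ) (m : ℕ) (f g : Cd d → ℂ) (z : Cd d) : ℂ :=
  ∫ θ in (0 : ℝ)..(2 * Real.pi),
    conj (shiftProd α m f (expi θ • z)) * shiftProd β m g (expi θ • z)

theorem circ_of_notMem {d : ℕ} (α β : ℝ) (m : ℕ) {f g : Cd d → ℂ} (hf : IsHol f) {z : Cd d}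
    (hz : z ∉ unitBall d) : circ α β m f g z = 0 := by
  have h : ∀ θ, expi θ • z ∉ unitBall d := fun θ => by
    simpa [mem_unitBall, norm_smul, norm_expi] using hz
  simp [circ, (hf.shiftProd α m).2 _ (h _)]

theorem hasSum_circ {d : ℕ} (α β : ℝ) (m : ℕ) {f g : Cd d → ℂ} (hf : IsHol f) (hg : IsHol g)
    {z : Cd d} (hz : z ∈ unitBall d) {a b : ℕ → ℂ} (ha : Slice f z a) (hb : Slice g z b) :
    HasSum (fun k => ((2 * Real.pi * (symb α m k * symb β m k) : ℝ) : ℂ) * (conj (a k) * b k))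
      (circ α β m f g z) := by
  have hz1 : ‖z‖ < 1 := mem_unitBall.1 hz
  have hA := ha.shiftProd α m hf
  have hB := hb.shiftProd β m hg
  have hn : ∀ θ, ‖expi θ • z‖ < 1 := fun θ => by simpa [norm_smul, norm_expi] using hz1
  have hcont : Continuous fun θ => shiftProd α m f (expi θ • z) :=
    (continuousOn_of_isHol (hf.shiftProd α m)).comp_continuous
      (continuous_expi.smul continuous_const) fun θ => mem_unitBall.2 (hn θ)
  have h := hasSum_parseval hcont
    (by simpa using hA.summable zero_le_one (by simpa using hz1))
    (by simpa using hB.summable zero_le_one (by simpa using hz1))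
    (fun θ => hA _ (hn θ)) (fun θ => hB _ (hn θ))
  refine h.congr_fun fun k => ?_
  simp only [map_mul, Complex.conj_ofReal]
  push_cast
  ring

theorem circ_conj {d : ℕ} (α β : ℝ) (m : ℕ) {f g : Cd d → ℂ} (hf : IsHol f) (hg : IsHol g)
    (z : Cd d) : conj (circ α β m g f z) = circ α β m f g z := by
  by_cases hz : z ∈ unitBall d
  · obtain ⟨a, ha⟩ := hf.exists_slice z
    obtain ⟨b, hb⟩ := hg.exists_slice z
    have h1 := Complex.hasSum_conj'.2 (by simpa using hasSum_circ α β m hg hf hz hb ha)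
    refine HasSum.unique h1 ((hasSum_circ α β m hf hg hz ha hb).congr_fun fun k => ?_)
    simp only [map_mul, Complex.conj_conj, Complex.conj_ofReal]
    push_cast
    simp only [map_ofNat]
    ring
  · rw [circ_of_notMem α β m hg hz, circ_of_notMem α β m hf hz, map_zero]

theorem circ_self_le {d : ℕ} {α β : ℝ} (hα : 0 < α) (hβ : 0 < β) (m : ℕ) {f : Cd d → ℂ}
    (hf : IsHol f) (z : Cd d) :
    0 ≤ (circ α β 0 f f z).re ∧ (circ α β 0 f f z).re ≤ (circ α β m f f z).re := by
  by_cases hz : z ∈ unitBall d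
  · obtain ⟨a, ha⟩ := hf.exists_slice z
    have h0 := Complex.hasSum_re (hasSum_circ α β 0 hf hf hz ha ha)
    have h1 := Complex.hasSum_re (hasSum_circ α β m hf hf hz ha ha)
    have e : ∀ k, (conj (a k) * a k) = ((‖a k‖ ^ 2 : ℝ) : ℂ) := fun k => by
      rw [Complex.conj_mul']
      push_cast
      rfl
    simp only [e, ← Complex.ofReal_mul, Complex.ofReal_re] at h0 h1
    have s0 : ∀ (a : ℝ) (k : ℕ), symb a 0 k = 1 := fun a k => by simp [symb]
    simp only [s0] at h0
    refine ⟨h0.nonneg fun k => by positivity, hasSum_le (fun k => ?_) h0 h1⟩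
    have h2 := one_le_symb hα m k
    have h3 := one_le_symb hβ m k
    have h4 : 1 * 1 ≤ symb α m k * symb β m k := by gcongr
    gcongr
  · simp [circ_of_notMem _ _ _ hf hz]

/-! ### The generalized Bergman space as an inner product space -/

/-- The sesquilinear form `⟨A f, B g⟩` in `L²(μ_{lam+2n})`, where
`A = (I + N/(lam+n)) ⋯ (I + N/(lam+2n-1))` and `B = (I + N/lam) ⋯ (I + N/(lam+n-1))`. -/
def sobolevForm (d : ℕ) (lam : ℝ) (n : ℕ) (f g : Cd d → ℂ) : ℂ :=
  ∫ z, conj (shiftProd (lam + n) n f z) * shiftProd lam n g z ∂(bergmanMeasure d (lam + 2 * n))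

theorem integrable_conj_mul {d : ℕ} {σ : ℝ} {f g : Cd d → ℂ}
    (hf : MemLp f 2 (bergmanMeasure d σ)) (hg : MemLp g 2 (bergmanMeasure d σ)) :
    Integrable (fun z => conj (f z) * g z) (bergmanMeasure d σ) :=
  (show MemLp (fun z => conj (f z)) 2 (bergmanMeasure d σ) from hf.star).integrable_mul hg

theorem circ_integral {d : ℕ} {σ : ℝ} (α β : ℝ) (m : ℕ) {f g : Cd d → ℂ}
    (hf : IsHol f) (hg : IsHol g)
    (hf' : ∀ k ≤ m, MemLp (numberOp^[k] f) 2 (bergmanMeasure d σ))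
    (hg' : ∀ k ≤ m, MemLp (numberOp^[k] g) 2 (bergmanMeasure d σ)) :
    Integrable (circ α β m f g) (bergmanMeasure d σ) ∧
      ∫ z, circ α β m f g z ∂(bergmanMeasure d σ)
        = 2 * Real.pi * ∫ z, conj (shiftProd α m f z) * shiftProd β m g z ∂(bergmanMeasure d σ) := by
  refine rotation_average (k := fun z => conj (shiftProd α m f z) * shiftProd β m g z) ?_
    (integrable_conj_mul (memLp_shiftProd α m hf hf') (memLp_shiftProd β m hg hg'))
  exact ((RCLike.continuous_conj (K := ℂ)).measurable.comp (hf.shiftProd α m).measurable).mul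
    (hg.shiftProd β m).measurable

theorem normConst_pos {d : ℕ} {σ : ℝ} (h : d < σ) : 0 < normConst d σ := by
  have h0 : 0 < σ := (Nat.cast_nonneg d).trans_lt h
  have := Real.Gamma_pos_of_pos h0
  have := Real.Gamma_pos_of_pos (sub_pos.2 h)
  have := Real.pi_pos
  unfold normConst
  positivity

theorem volume_eq_zero_of_bergmanMeasure {d : ℕ} {σ : ℝ} (h : d < σ) {s : Set (Cd d)}
    (hs : MeasurableSet s) (hsub : s ⊆ unitBall d) (h0 : bergmanMeasure d σ s = 0) :
    volume s = 0 := by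
  have hpos : ∀ z ∈ s, 0 < 1 - ‖z‖ ^ 2 := fun z hz => by
    have := mem_unitBall.1 (hsub hz)
    nlinarith [norm_nonneg z]
  rw [bergmanMeasure, withDensity_apply_eq_zero (by fun_prop)] at h0
  have e1 : {z : Cd d | ENNReal.ofReal (normConst d σ * (1 - ‖z‖ ^ 2) ^ σ) ≠ 0} ∩ s = s := by
    refine Set.inter_eq_right.2 fun z hz => ?_
    have := mul_pos (normConst_pos h) (Real.rpow_pos_of_pos (hpos z hz) σ)
    simpa using this
  rw [e1, hypMeasure, withDensity_apply_eq_zero (by fun_prop)] at h0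
  have e2 : {z : Cd d | ENNReal.ofReal ((1 - ‖z‖ ^ 2) ^ (-((d : ℝ) + 1))) ≠ 0} ∩ s = s := by
    refine Set.inter_eq_right.2 fun z hz => ?_
    have := Real.rpow_pos_of_pos (hpos z hz) (-((d : ℝ) + 1))
    simpa using this
  rwa [e2, Measure.restrict_apply hs, Set.inter_eq_left.2 hsub] at h0

theorem sobolevForm_conj {d : ℕ} {lam : ℝ} {n : ℕ} (f g : sobolevSubmodule d lam n) :
    conj (sobolevForm d lam n g.1 f.1) = sobolevForm d lam n f.1 g.1 := by
  have h1 := (circ_integral (lam + n) lam n f.2.1 g.2.1 f.2.2 g.2.2).2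
  have h2 := (circ_integral (lam + n) lam n g.2.1 f.2.1 g.2.2 f.2.2).2
  have h3 := congrArg conj h2
  rw [← integral_conj] at h3
  simp_rw [circ_conj (lam + n) lam n f.2.1 g.2.1] at h3
  rw [h1] at h3
  simp only [map_mul, Complex.conj_ofReal, map_ofNat] at h3
  have hpi : (2 * Real.pi : ℂ) ≠ 0 := by simp [Real.pi_ne_zero]
  exact (mul_left_cancel₀ hpi h3).symm

theorem sobolevForm_re {d : ℕ} {lam : ℝ} {n : ℕ} (hlam : 0 < lam)
    (f : sobolevSubmodule d lam n) :
    ∫ z, ‖f.1 z‖ ^ 2 ∂(bergmanMeasure d (lam + 2 * n)) ≤ (sobolevForm d lam n f.1 f.1).re := by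
  have hn : 0 < lam + n := by positivity
  have h1 := circ_integral (lam + n) lam n f.2.1 f.2.1 f.2.2 f.2.2
  have h0 := circ_integral (lam + n) lam 0 f.2.1 f.2.1
    (fun k hk => f.2.2 k (by omega)) (fun k hk => f.2.2 k (by omega))
  have hle := integral_mono h0.1.re h1.1.re fun z => (circ_self_le hn hlam n f.2.1 z).2
  have e0 := integral_re h0.1
  have e1 := integral_re h1.1
  simp only [RCLike.re_to_complex] at e0 e1 hle
  rw [e0, e1, h0.2, h1.2] at hle
  have hre : ∀ w : ℂ, ((2 : ℂ) * Real.pi * w).re = 2 * Real.pi * w.re := fun w => by simp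
  rw [hre, hre] at hle
  have hle' := le_of_mul_le_mul_left hle (by positivity)
  refine le_trans (le_of_eq ?_) hle'
  have e : ∀ z, conj (shiftProd (lam + n) 0 f.1 z) * shiftProd lam 0 f.1 z
      = ((‖f.1 z‖ ^ 2 : ℝ) : ℂ) := fun z => by
    simp only [shiftProd]
    rw [Complex.conj_mul']
    push_cast
    rfl
  simp_rw [e]
  rw [integral_complex_ofReal, Complex.ofReal_re]

theorem sobolevForm_definite {d : ℕ} {lam : ℝ} {n : ℕ} (hlam : 0 < lam) (hn : d < lam + 2 * n)
    (f : sobolevSubmodule d lam n) (h : sobolevForm d lam n f.1 f.1 = 0) : f = 0 := by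
  have h1 := sobolevForm_re hlam f
  rw [h, Complex.zero_re] at h1
  have h2 : ∫ z, ‖f.1 z‖ ^ 2 ∂(bergmanMeasure d (lam + 2 * n)) = 0 :=
    le_antisymm h1 (integral_nonneg fun z => by positivity)
  have hL : MemLp f.1 2 (bergmanMeasure d (lam + 2 * n)) := f.2.2 0 (Nat.zero_le _)
  rw [integral_eq_zero_iff_of_nonneg (fun z => by positivity) ((memLp_two_iff_integrable_sq_norm hL.1).1 hL)] at h2
  have h3 : bergmanMeasure d (lam + 2 * n) {z | f.1 z ≠ 0} = 0 := by
    rw [← ae_iff (p := fun z => f.1 z = 0)]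
    filter_upwards [h2] with z hz
    simpa using hz
  have hsub : {z | f.1 z ≠ 0} ⊆ unitBall d := fun z hz => by
    by_contra hz'
    exact hz (f.2.1.2 z hz')
  have hm : MeasurableSet {z | f.1 z ≠ 0} := f.2.1.measurable (measurableSet_singleton 0).compl
  have h4 := volume_eq_zero_of_bergmanMeasure hn hm hsub h3
  have hopen : IsOpen {z | f.1 z ≠ 0} := by
    have h5 := (continuousOn_of_isHol f.2.1).isOpen_inter_preimage (isOpen_unitBall d)
      (isOpen_compl_singleton (x := (0 : ℂ)))
    have h6 : unitBall d ∩ f.1 ⁻¹' {0}ᶜ = {z | f.1 z ≠ 0} := Set.inter_eq_right.2 hsub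
    rwa [h6] at h5
  have h7 := hopen.measure_eq_zero_iff (μ := volume) |>.1 h4
  ext z
  by_contra hz
  exact (h7 ▸ (show z ∈ {z | f.1 z ≠ 0} from hz) : z ∈ (∅ : Set (Cd d)))

/-- The generalized Bergman space `H(B^d, lam)`, for `lam > 0` and an auxiliary `n` with
`lam + 2n > d`. -/
def GenBergman (d : ℕ) (lam : ℝ) (n : ℕ) (_hlam : 0 < lam) (_hn : (d : ℝ) < lam + 2 * n) : Type :=
  sobolevSubmodule d lam n

variable {d : ℕ} {lam : ℝ} {n : ℕ} {hlam : 0 < lam} {hn : (d : ℝ) < lam + 2 * n}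

instance : AddCommGroup (GenBergman d lam n hlam hn) :=
  inferInstanceAs (AddCommGroup (sobolevSubmodule d lam n))

instance : Module ℂ (GenBergman d lam n hlam hn) :=
  inferInstanceAs (Module ℂ (sobolevSubmodule d lam n))

/-- The holomorphic function underlying an element of the space (extended by `0`). -/
instance : CoeFun (GenBergman d lam n hlam hn) (fun _ => Cd d → ℂ) := ⟨fun f => f.1⟩

/-- The inner product `⟨f, g⟩_lam = ⟨A f, B g⟩`, conjugate-linear in the first variable. -/
instance innerCore : InnerProductSpace.Core ℂ (GenBergman d lam n hlam hn) where
  inner f g := sobolevForm d lam n f g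
  conj_inner_symm f g := sobolevForm_conj f g
  re_inner_nonneg f := (integral_nonneg fun z => by positivity).trans (sobolevForm_re hlam f)
  add_left f g h := by
    change sobolevForm d lam n (f.1 + g.1) h.1 = _
    have hf := memLp_shiftProd (lam + n) n f.2.1 f.2.2
    have hg := memLp_shiftProd (lam + n) n g.2.1 g.2.2
    have hh := memLp_shiftProd lam n h.2.1 h.2.2
    rw [sobolevForm, shiftProd_add _ _ f.2.1 g.2.1, sobolevForm, sobolevForm,
      ← integral_add (integrable_conj_mul hf hh) (integrable_conj_mul hg hh)]
    simp only [Pi.add_apply, map_add, add_mul]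
  smul_left f g c := by
    change sobolevForm d lam n (c • f.1) g.1 = _
    rw [sobolevForm, shiftProd_smul _ _ _ f.2.1, sobolevForm, ← integral_const_mul]
    simp only [Pi.smul_apply, smul_eq_mul, map_mul, mul_assoc]
  definite f h := sobolevForm_definite hlam hn f h

instance : NormedAddCommGroup (GenBergman d lam n hlam hn) := innerCore.toNormedAddCommGroup

instance : InnerProductSpace ℂ (GenBergman d lam n hlam hn) :=
  InnerProductSpace.ofCore innerCore.toCore

theorem inner_def (f g : GenBergman d lam n hlam hn) :
    ⟪f, g⟫_ℂ = ∫ z, conj (shiftProd (lam + n) n f z) * shiftProd lam n g z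
      ∂(bergmanMeasure d (lam + 2 * n)) := rfl

/-! ### Hilbert–Schmidt operators -/

/-- `∑ ‖T e_i‖²` over an orthonormal basis `(e_i)`. -/
def hsSum {E : Type} [NormedAddCommGroup E] [InnerProductSpace ℂ E] {ι : Type}
    (b : HilbertBasis ι ℂ E) (T : E →L[ℂ] E) : ℝ≥0∞ := ∑' i, ‖T (b i)‖ₑ ^ 2

/-- A bounded operator is Hilbert–Schmidt if there is an orthonormal basis `(e_i)` with
`∑ ‖T e_i‖² < ∞`. -/
def IsHilbertSchmidt {E : Type} [NormedAddCommGroup E] [InnerProductSpace ℂ E]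
    (T : E →L[ℂ] E) : Prop :=
  ∃ (ι : Type) (b : HilbertBasis ι ℂ E), hsSum b T < ∞

/-- The Hilbert–Schmidt norm `(∑ ‖T e_i‖²)^{1/2}`. The sum is the same for all orthonormal bases
`(e_i)`; the definition takes the supremum over all of them. -/
def hsNorm {E : Type} [NormedAddCommGroup E] [InnerProductSpace ℂ E] (T : E →L[ℂ] E) : ℝ≥0∞ :=
  ⨆ (ι : Type) (b : HilbertBasis ι ℂ E), hsSum b T ^ (1 / 2 : ℝ)

/-! ### Toeplitz operators -/

/-- The integrand `conj (f z) φ(z) g(z) (1 - |z|²)^lam`. -/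
def toeplitzIntegrand (lam : ℝ) (φ f g : Cd d → ℂ) (z : Cd d) : ℂ :=
  conj (f z) * φ z * g z * (((1 - ‖z‖ ^ 2) ^ lam : ℝ) : ℂ)

/-- `T` has the matrix entries
`⟨f, T g⟩ = c_lam ∫ conj (f z) φ(z) g(z) (1 - |z|²)^lam dτ(z)`
for all bounded `f`, `g` in the space. -/
def HasToeplitzEntries (φ : Cd d → ℂ)
    (T : GenBergman d lam n hlam hn →L[ℂ] GenBergman d lam n hlam hn) : Prop :=
  ∀ f g : GenBergman d lam n hlam hn,
    (∃ C, ∀ z ∈ unitBall d, ‖f z‖ ≤ C) → (∃ C, ∀ z ∈ unitBall d, ‖g z‖ ≤ C) →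
      ⟪f, T g⟫_ℂ = (normConst d lam : ℂ) * ∫ z, toeplitzIntegrand lam φ f g z ∂(hypMeasure d)

end Bergman

end

/-! The space `H(B^d, λ)` has a reproducing kernel whose diagonal is `(1 - |z|²)^(-λ)`, that is,
`|f(z)|² (1 - |z|²)^λ ≤ ‖f‖²` (`norm_apply_sq_le`). The weight in the Toeplitz form cancels this
growth, so the form is bounded on the whole space by the `L¹(τ)` norm of `φ`, and the Riesz theorem
turns it into an operator (`exists_toeplitz`). Morally `T_φ` is `c_λ` times a superposition, with
density `φ dτ`, of rank-one operators of norm at most one.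

For the Hilbert–Schmidt bound, take a finite orthonormal family `b_i`, put `S = ∑ ‖T b_i‖²` and test
the form on the pairs `(T b_i, b_i)`. By Cauchy–Schwarz and the kernel bound, `∑ |T b_i(z)| |b_i(z)|
(1 - |z|²)^λ ≤ √S`. Hence `S ≤ M √S` with `M = |c_λ| ‖φ‖₁`, and so `S ≤ M²`
(`sum_norm_sq_toeplitz_le`).

The kernel bound comes from the functions `⟨e, z⟩^k` with `|e| = 1`. Averaging over unitary maps
shows that pairing with `⟨e, ·⟩^k` in `L²(μ_σ)` picks out the `k`-th Taylor coefficient along the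
line through `e`, times a moment of `μ_σ` (`integral_conj_powFn_mul`). The eigenvalues of `A` and
`B` change the moment for `λ + 2n` into the one for `λ`, whatever `n` is (`symb_mul_moment`). The
reciprocals of these moments are the coefficients of the binomial series of `(1 - x)^(-λ)`
(`hasSum_moment`).

The Riesz theorem needs completeness (`completeSpace_genBergman`): Cauchy sequences converge locally
uniformly by the kernel bound, the limit is analytic by Cauchy estimates, and Fatou's lemma puts it
in the space. Uniqueness holds because bounded functions separate points: with `f_ρ(z) = f(ρz)` one
has `⟨f_{ρ²}, f⟩ = ‖f_ρ‖²`, and `f_{ρ²}` is bounded for `ρ < 1` (`eq_zero_of_inner_bounded`). -/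

namespace Bergman

/-! ### Cauchy estimates and locally uniform limits of analytic functions -/

section Limits

open Metric Filter Topology

variable {E F : Type*} [NormedAddCommGroup E] [NormedSpace ℂ E] [NormedAddCommGroup F]
  [NormedSpace ℂ F] [CompleteSpace F]

/-- Each differentiation gives up a shell of width `r` and costs a factor `2 / r`: the Cauchy
estimate on a ball of radius `r` involves the oscillation of the function, which is at most twice
its bound. -/
theorem norm_iteratedFDeriv_le_of_bound {f : E → F} {c : E} {R M r : ℝ}
    (hf : AnalyticOnNhd ℂ f (ball c R)) (hM : ∀ z ∈ ball c R, ‖f z‖ ≤ M) (hr : 0 < r) (k : ℕ) :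
    ∀ z, dist z c + k * r < R → ‖iteratedFDeriv ℂ k f z‖ ≤ M * (2 / r) ^ k := by
  induction k with
  | zero =>
    intro z hz
    simpa using hM z (by simpa using hz)
  | succ k ih =>
    intro z hz
    push_cast at hz
    have hsub : ∀ w ∈ ball z r, dist w c + k * r < R := fun w hw => by
      have h1 := dist_triangle w z c
      have h2 := mem_ball.1 hw
      linarith
    have hsub' : ball z r ⊆ ball c R := fun w hw => by
      have h1 := hsub w hw
      have h2 : 0 ≤ k * r := by positivity
      rw [mem_ball]
      linarith
    have hd : DifferentiableOn ℂ (iteratedFDeriv ℂ k f) (ball z r) :=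
      ((hf.iteratedFDeriv k).mono hsub').differentiableOn
    have hmaps : Set.MapsTo (iteratedFDeriv ℂ k f) (ball z r)
        (closedBall (iteratedFDeriv ℂ k f z) (2 * (M * (2 / r) ^ k))) := fun w hw => by
      rw [mem_closedBall, dist_eq_norm]
      have h1 := ih w (hsub w hw)
      have h2 := ih z (hsub z (mem_ball_self hr))
      linarith [norm_sub_le (iteratedFDeriv ℂ k f w) (iteratedFDeriv ℂ k f z)]
    have := Complex.norm_fderiv_le_div_of_mapsTo_ball hd hmaps hr
    rw [norm_fderiv_iteratedFDeriv] at this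
    refine this.trans (le_of_eq ?_)
    rw [pow_succ]
    ring

/-- The Taylor series at `c`. -/
noncomputable def taylor (f : E → F) (c : E) : FormalMultilinearSeries ℂ E F :=
  fun k => ((k.factorial : ℂ)⁻¹) • iteratedFDeriv ℂ k f c

/-- The radius is divided into `k + 1` equal steps, of which `k` are used. The resulting `(k + 1)^k
/ k!` is at most `e^(k + 1)`. The rate is not sharp, but it depends on `f` only through the sup
bound `M`, and linearly, which is what limits require. -/
theorem norm_taylor_le {f : E → F} {c : E} {R M : ℝ} (hR : 0 < R)
    (hf : AnalyticOnNhd ℂ f (ball c R)) (hM : ∀ z ∈ ball c R, ‖f z‖ ≤ M) (k : ℕ) :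
    ‖taylor f c k‖ ≤ M * Real.exp 1 * (2 * Real.exp 1 / R) ^ k := by
  have hM0 : 0 ≤ M := (norm_nonneg _).trans (hM c (mem_ball_self hR))
  have hk : (0 : ℝ) < k + 1 := by positivity
  have h := norm_iteratedFDeriv_le_of_bound (r := R / (k + 1)) hf hM (by positivity) k c (by
    rw [dist_self, zero_add, ← mul_div_assoc, div_lt_iff₀ hk]
    nlinarith)
  have hfac : (0 : ℝ) < k.factorial := by exact_mod_cast k.factorial_pos
  have he := Real.pow_div_factorial_le_exp (k + 1 : ℝ) hk.le (k + 1)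
  have he' : ((k : ℝ) + 1) ^ k ≤ Real.exp 1 * Real.exp 1 ^ k * k.factorial := by
    rw [Nat.factorial_succ, div_le_iff₀ (by positivity)] at he
    have e1 : Real.exp (k + 1 : ℝ) = Real.exp 1 * Real.exp 1 ^ k := by
      rw [← Real.exp_nat_mul, ← Real.exp_add]
      congr 1
      ring
    rw [e1, pow_succ] at he
    push_cast at he
    refine le_of_mul_le_mul_right (he.trans (le_of_eq ?_)) hk
    ring
  rw [taylor, norm_smul, norm_inv, Complex.norm_natCast, inv_mul_le_iff₀ hfac]
  refine h.trans ?_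
  have e2 : 2 / (R / ((k : ℝ) + 1)) = 2 / R * (k + 1) := by field_simp
  rw [e2, mul_pow]
  calc M * ((2 / R) ^ k * ((k : ℝ) + 1) ^ k)
      ≤ M * ((2 / R) ^ k * (Real.exp 1 * Real.exp 1 ^ k * k.factorial)) := by gcongr
    _ = _ := by
      rw [show 2 * Real.exp 1 / R = 2 / R * Real.exp 1 by ring, mul_pow]
      ring

/-- Analyticity gives the expansion only on some small ball of unknown radius. The coefficient bound
makes the Taylor series converge on a ball whose radius depends on `R` alone, and the identity
theorem carries the equality there. -/
theorem hasFPowerSeriesOnBall_taylor {f : E → F} {c : E} {R M : ℝ} (hR : 0 < R)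
    (hf : AnalyticOnNhd ℂ f (ball c R)) (hM : ∀ z ∈ ball c R, ‖f z‖ ≤ M) :
    HasFPowerSeriesOnBall f (taylor f c) c (ENNReal.ofReal (R / (2 * Real.exp 1))) := by
  have he : 0 < Real.exp 1 := Real.exp_pos 1
  have he1 : 1 ≤ Real.exp 1 := Real.one_le_exp zero_le_one
  set ρ := R / (2 * Real.exp 1) with hρ
  have hρ0 : 0 < ρ := by positivity
  have hρR : ρ ≤ R := by
    rw [hρ, div_le_iff₀ (by positivity)]
    nlinarith
  have hrad : ENNReal.ofReal ρ ≤ (taylor f c).radius := by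
    refine (taylor f c).le_radius_of_bound (M * Real.exp 1) fun k => ?_
    rw [Real.coe_toNNReal _ hρ0.le]
    have h := norm_taylor_le hR hf hM k
    calc ‖taylor f c k‖ * ρ ^ k
        ≤ M * Real.exp 1 * (2 * Real.exp 1 / R) ^ k * ρ ^ k := by gcongr
      _ = M * Real.exp 1 := by
        rw [mul_assoc, ← mul_pow, hρ]
        have : 2 * Real.exp 1 / R * (R / (2 * Real.exp 1)) = 1 := by field_simp
        rw [this, one_pow, mul_one]
  have hpos : 0 < ENNReal.ofReal ρ := ENNReal.ofReal_pos.2 hρ0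
  have hp := ((taylor f c).hasFPowerSeriesOnBall (hpos.trans_le hrad)).mono hpos hrad
  have hp' := hp.comp_sub c
  rw [zero_add] at hp'
  refine hp'.congr ?_
  obtain ⟨q, hq⟩ := hf c (mem_ball_self hR)
  obtain ⟨r, hq⟩ := hq
  have hev : (fun z => (taylor f c).sum (z - c)) =ᶠ[𝓝 c] f := by
    filter_upwards [eball_mem_nhds c (lt_min hpos hq.r_pos)] with z hz
    have hz' : z - c ∈ eball (0 : E) r := by
      rw [mem_eball, edist_zero_right]
      rw [mem_eball, edist_eq_enorm_sub] at hz
      exact hz.trans_le (min_le_right _ _)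
    have h1 := hq.hasSum_iteratedFDeriv hz'
    rw [add_sub_cancel] at h1
    rw [← h1.tsum_eq]
    rfl
  have han : AnalyticOnNhd ℂ (fun z => (taylor f c).sum (z - c)) (eball c (ENNReal.ofReal ρ)) :=
    hp'.analyticOnNhd
  refine han.eqOn_of_preconnected_of_eventuallyEq (hf.mono ?_) ?_ (mem_eball_self hpos) hev
  · rw [eball_ofReal]
    exact ball_subset_ball hρR
  · rw [eball_ofReal]
    exact (convex_ball c ρ).isPreconnected

theorem taylor_sub {f g : E → F} {c : E} {R : ℝ} (hR : 0 < R) (hf : AnalyticOnNhd ℂ f (ball c R))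
    (hg : AnalyticOnNhd ℂ g (ball c R)) (k : ℕ) :
    taylor (f - g) c k = taylor f c k - taylor g c k := by
  have h := iteratedFDeriv_sub_apply (i := k) (x := c) (hf c (mem_ball_self hR)).contDiffAt
    (hg c (mem_ball_self hR)).contDiffAt
  simp only [taylor, h, smul_sub]

/-- A locally uniform limit of analytic functions of several complex variables is analytic. -/
theorem analyticAt_of_tendstoUniformlyOn {f : ℕ → E → F} {g : E → F} {c : E} {R : ℝ} (hR : 0 < R)
    (hf : ∀ m, AnalyticOnNhd ℂ (f m) (ball c R)) (hM : ∀ m, ∃ M, ∀ z ∈ ball c R, ‖f m z‖ ≤ M)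
    (hlim : TendstoUniformlyOn f g atTop (ball c R)) : AnalyticAt ℂ g c := by
  have he : 0 < Real.exp 1 := Real.exp_pos 1
  set C : ℕ → ℝ := fun k => Real.exp 1 * (2 * Real.exp 1 / R) ^ k with hC
  have hC0 : ∀ k, 0 < C k := fun k => by positivity
  rw [Metric.tendstoUniformlyOn_iff] at hlim
  -- Since the Taylor bound is linear in the sup norm, applying it to `f m - f l` makes the
  -- coefficients Cauchy, uniformly in `k` relative to the weights `C k`.
  have key : ∀ ε > 0, ∃ N, ∀ m ≥ N, ∀ l ≥ N, ∀ k,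
      ‖taylor (f m) c k - taylor (f l) c k‖ ≤ ε * C k := by
    intro ε hε
    obtain ⟨N, hN⟩ := eventually_atTop.1 (hlim (ε / 2) (by positivity))
    refine ⟨N, fun m hm l hl k => ?_⟩
    rw [← taylor_sub hR (hf m) (hf l)]
    refine (norm_taylor_le hR ((hf m).sub (hf l)) (M := ε) (fun z hz => ?_) k).trans
      (le_of_eq (by rw [hC]; ring))
    have h1 := hN m hm z hz
    have h2 := hN l hl z hz
    rw [Pi.sub_apply, ← dist_eq_norm]
    have h3 := dist_triangle_left (f m z) (f l z) (g z)
    linarith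
  have hq : ∀ k, ∃ q, Tendsto (fun m => taylor (f m) c k) atTop (𝓝 q) := fun k => by
    refine cauchySeq_tendsto_of_complete (Metric.cauchySeq_iff.2 fun ε hε => ?_)
    obtain ⟨N, hN⟩ := key (ε / 2 / C k) (by have := hC0 k; positivity)
    refine ⟨N, fun m hm l hl => ?_⟩
    have h1 := hN m hm l hl k
    rw [div_mul_cancel₀ _ (hC0 k).ne'] at h1
    rw [dist_eq_norm]
    linarith
  choose q hq using hq
  have key' : ∀ ε > 0, ∃ N, ∀ m ≥ N, ∀ k, ‖taylor (f m) c k - q k‖ ≤ ε * C k := by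
    intro ε hε
    obtain ⟨N, hN⟩ := key ε hε
    refine ⟨N, fun m hm k => ?_⟩
    refine le_of_tendsto ((tendsto_const_nhds.sub (hq k)).norm) ?_
    filter_upwards [eventually_ge_atTop N] with l hl
    exact hN m hm l hl k
  -- Half of the radius on which each `f m` equals its Taylor series, so that `C k * ρ ^ k` is
  -- geometric with ratio `1 / 2`.
  set ρ := R / (4 * Real.exp 1) with hρ
  have hρ0 : 0 < ρ := by positivity
  have he1 : 1 ≤ Real.exp 1 := Real.one_le_exp zero_le_one
  have hCρ : ∀ k, C k * ρ ^ k = Real.exp 1 * (1 / 2) ^ k := fun k => by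
    rw [hC, hρ]
    simp only
    rw [mul_assoc, ← mul_pow]
    congr 2
    field_simp
    norm_num
  have hρR : ρ < R / (2 * Real.exp 1) := by
    rw [hρ]
    exact div_lt_div_of_pos_left hR (by positivity) (by linarith)
  have hqb : ∃ K, ∀ k, ‖q k‖ ≤ K * C k := by
    obtain ⟨N, hN⟩ := key' 1 one_pos
    obtain ⟨M, hM⟩ := hM N
    refine ⟨M + 1, fun k => ?_⟩
    have h1 := hN N le_rfl k
    have h2 := norm_taylor_le hR (hf N) hM k
    have h3 := norm_sub_le (taylor (f N) c k) (taylor (f N) c k - q k)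
    rw [sub_sub_cancel] at h3
    have h4 : M * Real.exp 1 * (2 * Real.exp 1 / R) ^ k = M * C k := by rw [hC]; ring
    linarith
  obtain ⟨K, hK⟩ := hqb
  have hgeo : Summable fun k : ℕ => Real.exp 1 * (1 / 2 : ℝ) ^ k :=
    (summable_geometric_of_lt_one (by norm_num) (by norm_num)).mul_left _
  have hpt : ∀ (p : FormalMultilinearSeries ℂ E F) (K : ℝ), (∀ k, ‖p k‖ ≤ K * C k) →
      ∀ y : E, ‖y‖ ≤ ρ → ∀ k, ‖p k fun _ => y‖ ≤ K * (Real.exp 1 * (1 / 2) ^ k) := by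
    intro p K hp y hy k
    rw [← hCρ, ← mul_assoc]
    refine ((p k).le_opNorm _).trans ?_
    rw [Finset.prod_const, Finset.card_fin]
    have := (norm_nonneg _).trans (hp k)
    gcongr
    exact hp k
  refine ⟨q, ENNReal.ofReal ρ, ⟨?_, ENNReal.ofReal_pos.2 hρ0, fun {y} hy => ?_⟩⟩
  · refine FormalMultilinearSeries.le_radius_of_bound _ (K * Real.exp 1) fun k => ?_
    rw [Real.coe_toNNReal _ hρ0.le]
    calc ‖q k‖ * ρ ^ k ≤ K * C k * ρ ^ k := by gcongr; exact hK k
      _ = K * Real.exp 1 * (1 / 2) ^ k := by rw [mul_assoc, hCρ, mul_assoc]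
      _ ≤ K * Real.exp 1 * 1 := by
        have h0 : 0 ≤ K := by
          have := (norm_nonneg _).trans (hK 0)
          exact nonneg_of_mul_nonneg_left this (hC0 0)
        gcongr
        exact pow_le_one₀ (by norm_num) (by norm_num)
      _ = _ := mul_one _
  · rw [eball_ofReal, mem_ball_zero_iff] at hy
    have hsum : Summable fun k => q k fun _ => y :=
      Summable.of_norm_bounded (hgeo.mul_left K) (hpt q K hK y hy.le)
    have heq : ∑' k, (q k fun _ => y) = g (c + y) := by
      have hyR : c + y ∈ ball c R := by
        rw [mem_ball, dist_self_add_left]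
        refine hy.trans_le (hρR.le.trans ?_)
        rw [div_le_iff₀ (by positivity)]
        nlinarith
      refine eq_of_forall_dist_le fun ε hε => ?_
      set S := ∑' k : ℕ, Real.exp 1 * (1 / 2 : ℝ) ^ k
      have hS : 0 ≤ S := tsum_nonneg fun k => by positivity
      obtain ⟨δ, hδ, hδε⟩ : ∃ δ > 0, δ * S + δ ≤ ε :=
        ⟨ε / (S + 1), by positivity, by field_simp; rfl⟩
      obtain ⟨N, hN⟩ := key' δ hδ
      obtain ⟨N', hN'⟩ := eventually_atTop.1 (hlim δ hδ)
      set m := max N N'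
      obtain ⟨M, hM⟩ := hM m
      have h1 : HasSum (fun k => taylor (f m) c k fun _ => y) (f m (c + y)) :=
        (hasFPowerSeriesOnBall_taylor hR (hf m) hM).hasSum (by
          rw [eball_ofReal, mem_ball_zero_iff]
          exact hy.trans hρR)
      have h2 := h1.sub hsum.hasSum
      have h3 : ‖f m (c + y) - ∑' k, (q k fun _ => y)‖ ≤ δ * S := by
        rw [← h2.tsum_eq, ← tsum_mul_left]
        refine tsum_of_norm_bounded (hgeo.mul_left δ).hasSum fun k => ?_
        exact hpt (fun k => taylor (f m) c k - q k) δ (fun k => hN m (le_max_left _ _) k) y hy.le k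
      have h4 := hN' m (le_max_right _ _) _ hyR
      rw [← dist_eq_norm, dist_comm] at h3
      have := dist_triangle_right (∑' k, (q k fun _ => y)) (g (c + y)) (f m (c + y))
      linarith
    rw [← heq]
    exact hsum.hasSum

end Limits

/-! ### Moments of `bergmanMeasure` -/

theorem lintegral_Gamma {a : ℝ} (ha : 0 < a) :
    ∫⁻ t in Set.Ioi 0, ENNReal.ofReal (Real.exp (-t) * t ^ (a - 1))
      = ENNReal.ofReal (Real.Gamma a) := by
  rw [Real.Gamma_eq_integral ha, ofReal_integral_eq_lintegral_ofReal (Real.GammaIntegral_convergent ha)]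
  filter_upwards [self_mem_ae_restrict measurableSet_Ioi] with t ht
  have := Real.rpow_nonneg (le_of_lt ht) (a - 1)
  have := Real.exp_pos (-t)
  positivity

theorem finrank_real_Cd (d : ℕ) : Module.finrank ℝ (Cd d) = 2 * d := by
  rw [finrank_real_of_complex]
  simp

theorem lintegral_gaussian_Cd (d : ℕ) :
    ∫⁻ z : Cd d, ENNReal.ofReal (Real.exp (-‖z‖ ^ 2)) = ENNReal.ofReal (Real.pi ^ d) := by
  have h := GaussianFourier.integral_rexp_neg_mul_sq_norm (V := Cd d) one_pos
  rw [finrank_real_Cd] at h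
  have e : (Real.pi / 1) ^ (((2 * d : ℕ) : ℝ) / 2) = Real.pi ^ d := by
    rw [div_one, ← Real.rpow_natCast]
    congr 1
    push_cast
    ring
  rw [e] at h
  simp only [neg_mul, one_mul] at h
  rw [← h, ofReal_integral_eq_lintegral_ofReal]
  · by_contra hc
    rw [integral_undef hc] at h
    exact (pow_pos Real.pi_pos d).ne h
  · exact .of_forall fun z => by positivity

theorem lintegral_gaussian_moment (k : ℕ) :
    ∫⁻ z : ℂ, ENNReal.ofReal (‖z‖ ^ (2 * k) * Real.exp (-‖z‖ ^ 2))
      = ENNReal.ofReal (Real.pi * k.factorial) := by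
  have h := Complex.integral_rpow_mul_exp_neg_rpow (p := 2) (q := (2 * k : ℕ)) one_le_two
    (by linarith [Nat.cast_nonneg (α := ℝ) (2 * k)])
  have e : 2 * Real.pi / 2 * Real.Gamma ((((2 * k : ℕ) : ℝ) + 2) / 2) = Real.pi * k.factorial := by
    rw [← Real.Gamma_nat_eq_factorial]
    push_cast
    congr 2
    · ring
    · ring
  rw [e] at h
  simp only [Real.rpow_natCast, Real.rpow_ofNat] at h
  rw [← h, ofReal_integral_eq_lintegral_ofReal]
  · by_contra hc
    rw [integral_undef hc] at h
    have : 0 < Real.pi * k.factorial :=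
      mul_pos Real.pi_pos (by exact_mod_cast k.factorial_pos)
    exact this.ne h
  · exact .of_forall fun z => by positivity

/-- An isometric splitting of `ℂ^(d+1)` along a unit vector. -/
theorem exists_isometry_split {d : ℕ} {e : Cd (d + 1)} (he : ‖e‖ = 1) :
    ∃ V : Cd (d + 1) ≃ₗᵢ[ℝ] WithLp 2 (ℂ × Cd d), ∀ z, (V z).fst = ⟪e, z⟫_ℂ := by
  obtain ⟨b, hb⟩ := Orthonormal.exists_orthonormalBasis_extension_of_card_eq (𝕜 := ℂ)
    (E := Cd (d + 1)) (ι := Fin (d + 1)) (by simp) (v := fun _ => e) (s := {0}) (by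
      refine ⟨fun i => he, fun i j hij => (hij (Subsingleton.elim i j)).elim⟩)
  have hb0 : b 0 = e := hb 0 rfl
  let L : Cd (d + 1) →ₗ[ℂ] WithLp 2 (ℂ × Cd d) :=
    { toFun := fun z => WithLp.toLp 2 (⟪b 0, z⟫_ℂ, WithLp.toLp 2 fun i : Fin d => ⟪b i.succ, z⟫_ℂ)
      map_add' := fun x y => by
        refine (WithLp.ofLp_injective 2) (Prod.ext ?_ ?_)
        · simp
        · ext i
          simp
      map_smul' := fun c x => by
        refine (WithLp.ofLp_injective 2) (Prod.ext ?_ ?_)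
        · simp
        · ext i
          simp }
  let V : Cd (d + 1) →ₗᵢ[ℝ] WithLp 2 (ℂ × Cd d) := ⟨L.restrictScalars ℝ, fun z => by
    have h1 : ‖L z‖ ^ 2 = ‖z‖ ^ 2 := by
      rw [WithLp.prod_norm_sq_eq_of_L2, EuclideanSpace.norm_sq_eq, ← b.sum_sq_norm_inner_right z,
        Fin.sum_univ_succ]
      rfl
    exact (pow_left_inj₀ (norm_nonneg _) (norm_nonneg _) two_ne_zero).1 h1⟩
  have hfin : Module.finrank ℝ (Cd (d + 1)) = Module.finrank ℝ (WithLp 2 (ℂ × Cd d)) := by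
    rw [(WithLp.linearEquiv 2 ℝ (ℂ × Cd d)).finrank_eq, Module.finrank_prod, finrank_real_Cd,
      finrank_real_Cd, Complex.finrank_real_complex]
    ring
  refine ⟨V.toLinearIsometryEquiv hfin, fun z => ?_⟩
  rw [← hb0]
  rfl

/-- In orthonormal coordinates whose first vector is `e`, the integrand is a product: a one-variable
Gaussian moment times a pure Gaussian on `ℂ^(d-1)`. -/
theorem lintegral_gaussian_inner {d : ℕ} (hd : 1 ≤ d) {e : Cd d} (he : ‖e‖ = 1) (k : ℕ) :
    ∫⁻ z : Cd d, ENNReal.ofReal (‖⟪e, z⟫_ℂ‖ ^ (2 * k)) * ENNReal.ofReal (Real.exp (-‖z‖ ^ 2))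
      = ENNReal.ofReal (Real.pi ^ d * k.factorial) := by
  obtain ⟨d, rfl⟩ : ∃ d', d = d' + 1 := ⟨d - 1, by omega⟩
  obtain ⟨V, hV⟩ := exists_isometry_split he
  let G : ℂ × Cd d → ℝ≥0∞ := fun p => ENNReal.ofReal (‖p.1‖ ^ (2 * k) * Real.exp (-‖p.1‖ ^ 2)) *
    ENNReal.ofReal (Real.exp (-‖p.2‖ ^ 2))
  have hG : Measurable G := by fun_prop
  have hmp := (WithLp.volume_preserving_ofLp ℂ (Cd d)).comp V.measurePreserving
  have h := hmp.lintegral_comp hG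
  have e1 : ∀ z : Cd (d + 1), G ((WithLp.ofLp ∘ V) z) =
      ENNReal.ofReal (‖⟪e, z⟫_ℂ‖ ^ (2 * k)) * ENNReal.ofReal (Real.exp (-‖z‖ ^ 2)) := fun z => by
    have h1 : ‖z‖ ^ 2 = ‖⟪e, z⟫_ℂ‖ ^ 2 + ‖(V z).snd‖ ^ 2 := by
      rw [← V.norm_map z, WithLp.prod_norm_sq_eq_of_L2, hV]
    have h2 : (WithLp.ofLp (V z)).1 = ⟪e, z⟫_ℂ := hV z
    simp only [G, Function.comp_apply, h2]
    rw [← ENNReal.ofReal_mul (by positivity), ← ENNReal.ofReal_mul (by positivity), h1, neg_add,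
      Real.exp_add, mul_assoc]
    rfl
  simp only [e1] at h
  rw [h, Measure.volume_eq_prod]
  simp only [G]
  rw [lintegral_prod_mul
    (f := fun z : ℂ => ENNReal.ofReal (‖z‖ ^ (2 * k) * Real.exp (-‖z‖ ^ 2)))
    (g := fun z : Cd d => ENNReal.ofReal (Real.exp (-‖z‖ ^ 2))) (by fun_prop) (by fun_prop),
    lintegral_gaussian_moment, lintegral_gaussian_Cd, ← ENNReal.ofReal_mul (by positivity)]
  congr 1
  ring

theorem lintegral_comp_smul_Cd {d : ℕ} {F : Cd d → ℝ≥0∞} (hF : Measurable F) {r : ℝ} (hr : 0 < r) :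
    ∫⁻ z, F z = ENNReal.ofReal (r ^ (2 * d)) * ∫⁻ z, F (r • z) := by
  have h := Measure.map_addHaar_smul (volume : Measure (Cd d)) hr.ne'
  have h2 := lintegral_map (μ := volume) hF (measurable_const_smul r)
  rw [h, lintegral_smul_measure, finrank_real_Cd] at h2
  rw [← h2, smul_eq_mul, ← mul_assoc, ← ENNReal.ofReal_mul (by positivity),
    abs_of_pos (by positivity), mul_inv_cancel₀ (by positivity), ENNReal.ofReal_one, one_mul]

/-- Double counting: `|⟨e, z⟩|^(2k) e^(-|z|²)` times `e^(-u) u^(s-1)` at `u = t - |z|² > 0` is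
integrated over `(z, t)` in both orders. Integrating `t` first gives `Γ(s)` times a Gaussian moment.
Integrating `z` first, with the substitution `z = √t w`, gives `e^(-t) t^(s+d+k-1)` times the
integral sought, hence `Γ(s+d+k)` times it. -/
theorem lintegral_ball_inner {d : ℕ} (hd : 1 ≤ d) {e : Cd d} (he : ‖e‖ = 1) (k : ℕ) {s : ℝ}
    (hs : 0 < s) :
    ∫⁻ z in unitBall d, ENNReal.ofReal (‖⟪e, z⟫_ℂ‖ ^ (2 * k) * (1 - ‖z‖ ^ 2) ^ (s - 1))
      = ENNReal.ofReal (Real.pi ^ d * k.factorial * Real.Gamma s / Real.Gamma (s + d + k)) := by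
  set I := ∫⁻ z in unitBall d, ENNReal.ofReal (‖⟪e, z⟫_ℂ‖ ^ (2 * k) * (1 - ‖z‖ ^ 2) ^ (s - 1))
    with hI
  have hG := Real.Gamma_pos_of_pos (show 0 < s + d + k by positivity)
  let H : ℝ → ℝ≥0∞ := (Set.Ioi 0).indicator fun u => ENNReal.ofReal (Real.exp (-u) * u ^ (s - 1))
  have hH : Measurable H := Measurable.indicator (by fun_prop) measurableSet_Ioi
  have hHint : ∫⁻ u, H u = ENNReal.ofReal (Real.Gamma s) := by
    rw [lintegral_indicator measurableSet_Ioi, lintegral_Gamma hs]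
  let g : Cd d → ℝ≥0∞ := fun z =>
    ENNReal.ofReal (‖⟪e, z⟫_ℂ‖ ^ (2 * k)) * ENNReal.ofReal (Real.exp (-‖z‖ ^ 2))
  have hg : Measurable g := by fun_prop
  let Φ : Cd d → ℝ → ℝ≥0∞ := fun z t => g z * H (t - ‖z‖ ^ 2)
  have hΦ : Measurable (Function.uncurry Φ) := by
    refine (hg.comp measurable_fst).mul (hH.comp ?_)
    fun_prop
  have h1 : ∫⁻ z, ∫⁻ t, Φ z t
      = ENNReal.ofReal (Real.pi ^ d * k.factorial) * ENNReal.ofReal (Real.Gamma s) := by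
    have : ∀ z, ∫⁻ t, Φ z t = g z * ENNReal.ofReal (Real.Gamma s) := fun z => by
      rw [lintegral_const_mul _ (by fun_prop), lintegral_sub_right_eq_self (fun t => H t), hHint]
    simp_rw [this]
    rw [lintegral_mul_const _ hg, lintegral_gaussian_inner hd he]
  have h2 : ∀ t, ∫⁻ z, Φ z t = (Set.Ioi 0).indicator
      (fun t => ENNReal.ofReal (Real.exp (-t) * t ^ (s + d + k - 1))) t * I := by
    intro t
    by_cases ht : 0 < t
    · rw [Set.indicator_of_mem (Set.mem_Ioi.2 ht)]
      have hst : 0 < √t := Real.sqrt_pos.2 ht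
      have hsq : √t ^ 2 = t := Real.sq_sqrt ht.le
      rw [lintegral_comp_smul_Cd (F := fun z => Φ z t) (by fun_prop) hst, hI,
        ← lintegral_indicator (isOpen_unitBall d).measurableSet]
      -- The two exponentials merge into `e^(-t)`, and the condition `t - |√t z|² > 0` becomes
      -- membership in the unit ball. The missing factor `t^d` is the Jacobian of the scaling.
      have key : ∀ z : Cd d, Φ (√t • z) t = ENNReal.ofReal (Real.exp (-t) * t ^ (k + (s - 1))) *
          (unitBall d).indicator (fun z => ENNReal.ofReal
            (‖⟪e, z⟫_ℂ‖ ^ (2 * k) * (1 - ‖z‖ ^ 2) ^ (s - 1))) z := by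
        intro z
        have hn : ‖√t • z‖ ^ 2 = t * ‖z‖ ^ 2 := by
          rw [norm_smul, mul_pow, Real.norm_of_nonneg hst.le, hsq]
        have hi : ‖⟪e, √t • z⟫_ℂ‖ ^ (2 * k) = t ^ k * ‖⟪e, z⟫_ℂ‖ ^ (2 * k) := by
          rw [inner_smul_right_eq_smul, norm_smul, mul_pow, Real.norm_of_nonneg hst.le, pow_mul √t,
            hsq]
        simp only [Φ, g, hn, hi, H]
        by_cases hz : z ∈ unitBall d
        · have hz1 : 0 < 1 - ‖z‖ ^ 2 := by
            have := mem_unitBall.1 hz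
            nlinarith [norm_nonneg z]
          have hpos : 0 < t - t * ‖z‖ ^ 2 := by
            have := mul_pos ht hz1
            linarith
          rw [Set.indicator_of_mem hz, Set.indicator_of_mem (Set.mem_Ioi.2 hpos),
            ← ENNReal.ofReal_mul (by positivity), ← ENNReal.ofReal_mul (by positivity),
            ← ENNReal.ofReal_mul (by positivity)]
          congr 1
          have e1 : t - t * ‖z‖ ^ 2 = t * (1 - ‖z‖ ^ 2) := by ring
          have e2 : Real.exp (-t) = Real.exp (-(t * ‖z‖ ^ 2)) * Real.exp (-(t - t * ‖z‖ ^ 2)) := by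
            rw [← Real.exp_add]
            congr 1
            ring
          rw [e2, Real.rpow_add ht, Real.rpow_natCast, e1, Real.mul_rpow ht.le hz1.le]
          ring
        · have hpos : t - t * ‖z‖ ^ 2 ∉ Set.Ioi 0 := by
            have : 1 ≤ ‖z‖ := not_lt.1 fun h => hz (mem_unitBall.2 h)
            rw [Set.mem_Ioi, not_lt]
            nlinarith [mul_le_mul this this zero_le_one (norm_nonneg z)]
          rw [Set.indicator_of_notMem hz, Set.indicator_of_notMem hpos, mul_zero, mul_zero]
      simp_rw [key]
      rw [lintegral_const_mul', ← mul_assoc, ← ENNReal.ofReal_mul (by positivity)]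
      · congr 2
        rw [pow_mul, hsq, show s + d + k - 1 = (d : ℝ) + (k + (s - 1)) by ring,
          Real.rpow_add ht (d : ℝ), Real.rpow_natCast]
        ring
      · exact ENNReal.ofReal_ne_top
    · rw [Set.indicator_of_notMem (fun h => ht (Set.mem_Ioi.1 h)), zero_mul]
      have : ∀ z, Φ z t = 0 := fun z => by
        have : t - ‖z‖ ^ 2 ∉ Set.Ioi 0 := by
          rw [Set.mem_Ioi, not_lt]
          nlinarith [sq_nonneg ‖z‖]
        simp only [Φ, H, Set.indicator_of_notMem this, mul_zero]
      simp [this]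
  rw [lintegral_lintegral_swap hΦ.aemeasurable] at h1
  simp_rw [h2] at h1
  rw [lintegral_mul_const _ (Measurable.indicator (by fun_prop) measurableSet_Ioi),
    lintegral_indicator measurableSet_Ioi, lintegral_Gamma (by positivity)] at h1
  have hG0 : ENNReal.ofReal (Real.Gamma (s + d + k)) ≠ 0 := by simpa using hG
  rw [ENNReal.ofReal_div_of_pos hG, ENNReal.eq_div_iff hG0 ENNReal.ofReal_ne_top, h1,
    ← ENNReal.ofReal_mul (by positivity)]

theorem lintegral_bergmanMeasure {d : ℕ} {σ : ℝ} (h : d < σ) (F : Cd d → ℝ≥0∞) (hF : Measurable F) :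
    ∫⁻ z, F z ∂(bergmanMeasure d σ) = ENNReal.ofReal (normConst d σ) *
      ∫⁻ z in unitBall d, ENNReal.ofReal ((1 - ‖z‖ ^ 2) ^ (σ - d - 1)) * F z := by
  rw [bergmanMeasure, lintegral_withDensity_eq_lintegral_mul _ (by fun_prop) hF, hypMeasure,
    lintegral_withDensity_eq_lintegral_mul _ (by fun_prop) (by fun_prop),
    ← lintegral_const_mul' _ _ ENNReal.ofReal_ne_top]
  refine setLIntegral_congr_fun (isOpen_unitBall d).measurableSet fun z hz => ?_
  have hz1 : 0 < 1 - ‖z‖ ^ 2 := by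
    have := mem_unitBall.1 hz
    nlinarith [norm_nonneg z]
  simp only [Pi.mul_apply]
  rw [← mul_assoc, ← mul_assoc, ← ENNReal.ofReal_mul (by positivity),
    ← ENNReal.ofReal_mul (normConst_pos h).le]
  congr 2
  rw [show σ - d - 1 = -((d : ℝ) + 1) + σ by ring, Real.rpow_add hz1]
  ring

/-- The moments `∫ |⟨e, z⟩|^{2k} dμ_σ` for a unit vector `e`. -/
noncomputable def moment (σ : ℝ) (k : ℕ) : ℝ := Real.Gamma σ * k.factorial / Real.Gamma (σ + k)

theorem lintegral_inner_pow {d : ℕ} (hd : 1 ≤ d) {σ : ℝ} (h : d < σ) {e : Cd d} (he : ‖e‖ = 1)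
    (k : ℕ) : ∫⁻ z, ENNReal.ofReal (‖⟪e, z⟫_ℂ‖ ^ (2 * k)) ∂(bergmanMeasure d σ)
      = ENNReal.ofReal (moment σ k) := by
  rw [lintegral_bergmanMeasure h _ (by fun_prop)]
  have hs : 0 < σ - d := sub_pos.2 h
  have h1 := lintegral_ball_inner hd he k hs
  have e1 : ∀ z : Cd d, ENNReal.ofReal ((1 - ‖z‖ ^ 2) ^ (σ - d - 1)) *
      ENNReal.ofReal (‖⟪e, z⟫_ℂ‖ ^ (2 * k))
      = ENNReal.ofReal (‖⟪e, z⟫_ℂ‖ ^ (2 * k) * (1 - ‖z‖ ^ 2) ^ (σ - d - 1)) := fun z => by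
    rw [mul_comm, ← ENNReal.ofReal_mul (by positivity)]
  simp_rw [e1]
  rw [h1, ← ENNReal.ofReal_mul (normConst_pos h).le, normConst, moment]
  congr 1
  have := Real.Gamma_pos_of_pos hs
  have := Real.pi_pos
  rw [show σ - d + d + k = σ + k by ring]
  field_simp

theorem isFiniteMeasure_bergmanMeasure {d : ℕ} (hd : 1 ≤ d) {σ : ℝ} (h : d < σ) :
    IsFiniteMeasure (bergmanMeasure d σ) := by
  have h1 := lintegral_inner_pow hd h (e := EuclideanSpace.single ⟨0, hd⟩ 1) (by simp) 0
  refine ⟨?_⟩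
  rw [← lintegral_one]
  simp only [mul_zero, pow_zero, ENNReal.ofReal_one] at h1
  rw [h1]
  exact ENNReal.ofReal_lt_top

theorem integral_inner_pow {d : ℕ} (hd : 1 ≤ d) {σ : ℝ} (h : d < σ) {e : Cd d} (he : ‖e‖ = 1)
    (k : ℕ) : ∫ z, ‖⟪e, z⟫_ℂ‖ ^ (2 * k) ∂(bergmanMeasure d σ) = moment σ k := by
  rw [integral_eq_lintegral_of_nonneg_ae (.of_forall fun z => by positivity)
    (Continuous.aestronglyMeasurable (by fun_prop)), lintegral_inner_pow hd h he,
    ENNReal.toReal_ofReal]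
  have h0 : 0 < σ := (Nat.cast_nonneg d).trans_lt h
  have := Real.Gamma_pos_of_pos h0
  have := Real.Gamma_pos_of_pos (show 0 < σ + k by positivity)
  unfold moment
  positivity

/-! ### Gamma quotients: eigenvalues of the shift products, moments and the binomial series -/

theorem symb_eq {a : ℝ} (ha : 0 < a) (m k : ℕ) :
    symb a m k = Real.Gamma (a + m + k) * Real.Gamma a / (Real.Gamma (a + k) * Real.Gamma (a + m)) := by
  induction m with
  | zero =>
    have := Real.Gamma_pos_of_pos ha
    have := Real.Gamma_pos_of_pos (show 0 < a + k by positivity)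
    simp only [symb, Finset.range_zero, Finset.prod_empty, Nat.cast_zero, add_zero]
    field_simp
  | succ m ih =>
    rw [symb, Finset.prod_range_succ, ← symb, ih]
    have h1 := Real.Gamma_pos_of_pos (show 0 < a + k by positivity)
    have h2 := Real.Gamma_pos_of_pos (show 0 < a + m by positivity)
    have h3 : 0 < a + m := by positivity
    have h4 : 0 < a + m + k := by positivity
    push_cast
    rw [show a + (m + 1) + k = a + m + k + 1 by ring, show a + ((m : ℝ) + 1) = a + m + 1 by ring,
      Real.Gamma_add_one h3.ne', Real.Gamma_add_one h4.ne']
    field_simp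

/-- The squared norm in `H(B^d, lam)` of `⟨e, z⟩^k`, for a unit vector `e`. -/
theorem symb_mul_moment {lam : ℝ} (hlam : 0 < lam) (n k : ℕ) :
    symb (lam + n) n k * symb lam n k * moment (lam + 2 * n) k = moment lam k := by
  have h1 := Real.Gamma_pos_of_pos hlam
  have h2 := Real.Gamma_pos_of_pos (show 0 < lam + k by positivity)
  have h3 := Real.Gamma_pos_of_pos (show 0 < lam + n by positivity)
  have h4 := Real.Gamma_pos_of_pos (show 0 < lam + n + k by positivity)
  have h5 := Real.Gamma_pos_of_pos (show 0 < lam + 2 * n by positivity)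
  have h6 := Real.Gamma_pos_of_pos (show 0 < lam + 2 * n + k by positivity)
  -- In Gamma quotients everything involving `λ + n` and `λ + 2n` cancels, leaving `Γ(λ) k! / Γ(λ +
  -- k)`. This is why the form does not depend on `n`.
  rw [symb_eq hlam, symb_eq (by positivity), moment, moment,
    show lam + n + n = lam + 2 * (n : ℝ) by ring]
  field_simp

theorem moment_pos {σ : ℝ} (h : 0 < σ) (k : ℕ) : 0 < moment σ k := by
  have := Real.Gamma_pos_of_pos h
  have := Real.Gamma_pos_of_pos (show 0 < σ + k by positivity)
  unfold moment
  positivity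

theorem Gamma_add_natCast {a : ℝ} (ha : 0 < a) (k : ℕ) :
    Real.Gamma (a + k) = Real.Gamma a * (ascPochhammer ℕ k).smeval a := by
  induction k with
  | zero => simp
  | succ k ih =>
    have h : a + k ≠ 0 := by positivity
    rw [ascPochhammer_succ_right, mul_add, Polynomial.smeval_add, Polynomial.smeval_mul_X,
      ← Nat.cast_comm, ← nsmul_eq_mul, Polynomial.smeval_smul, nsmul_eq_mul]
    push_cast
    rw [← add_assoc, Real.Gamma_add_one h, ih]
    ring

/-- The reciprocal moment is `λ (λ + 1) ⋯ (λ + k - 1) / k!`, the `k`-th binomial coefficient of the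
series. With `x = |z|²` the sum is the diagonal of the reproducing kernel. -/
theorem hasSum_moment {lam : ℝ} (hlam : 0 < lam) {x : ℝ} (hx0 : 0 ≤ x) (hx : x < 1) :
    HasSum (fun k => x ^ k / moment lam k) ((1 - x) ^ (-lam)) := by
  have h := (Real.one_div_one_sub_rpow_hasFPowerSeriesOnBall_zero lam).hasSum (y := x) (by
    rw [Metric.mem_eball, edist_zero_right, ← ofReal_norm, Real.norm_of_nonneg hx0]
    simpa using hx)
  rw [zero_add, one_div, ← Real.rpow_neg (by linarith)] at h
  refine h.congr_fun fun k => ?_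
  rw [FormalMultilinearSeries.ofScalars_apply_eq, smul_eq_mul, div_eq_mul_inv, mul_comm]
  congr 1
  have h1 := Real.Gamma_pos_of_pos hlam
  have h2 := Ring.factorial_nsmul_multichoose_eq_ascPochhammer lam k
  have hfac : (0 : ℝ) < k.factorial := by exact_mod_cast k.factorial_pos
  rw [Ring.multichoose_eq, nsmul_eq_mul] at h2
  rw [moment, inv_div, Gamma_add_natCast hlam, ← h2]
  field_simp

/-! ### Invariance under isometries -/

theorem measurePreserving_isometry {d : ℕ} (σ : ℝ) (L : Cd d ≃ₗᵢ[ℝ] Cd d) :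
    MeasurePreserving L (bergmanMeasure d σ) (bergmanMeasure d σ) := by
  have h1 := L.measurePreserving.restrict_preimage (isOpen_unitBall d).measurableSet
  have e : L ⁻¹' unitBall d = unitBall d := by
    ext z
    simp [mem_unitBall]
  rw [e] at h1
  refine measurePreserving_withDensity (measurePreserving_withDensity h1 ?_ ?_) ?_ ?_
  · fun_prop
  · simp
  · fun_prop
  · simp

theorem ae_mem_unitBall (d : ℕ) (σ : ℝ) : ∀ᵐ z ∂(bergmanMeasure d σ), z ∈ unitBall d := by
  have h : bergmanMeasure d σ ≪ volume.restrict (unitBall d) :=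
    (withDensity_absolutelyContinuous _ _).trans (withDensity_absolutelyContinuous _ _)
  exact h.ae_le (ae_restrict_mem (isOpen_unitBall d).measurableSet)

/-- The Fubini argument of `rotation_average`, for an arbitrary continuous family of
measure-preserving maps; it is applied to the rotations `partialRot` fixing `e`. -/
theorem integral_average {d : ℕ} {σ : ℝ} {R : ℝ → Cd d → Cd d}
    (hR : Continuous (Function.uncurry R))
    (hp : ∀ θ, MeasurePreserving (R θ) (bergmanMeasure d σ) (bergmanMeasure d σ))
    {k : Cd d → ℂ} (hm : Measurable k) (hk : Integrable k (bergmanMeasure d σ)) :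
    Integrable (fun z => ∫ θ in (0 : ℝ)..(2 * Real.pi), k (R θ z)) (bergmanMeasure d σ) ∧
      ∫ z, (∫ θ in (0 : ℝ)..(2 * Real.pi), k (R θ z)) ∂(bergmanMeasure d σ)
        = 2 * Real.pi * ∫ z, k z ∂(bergmanMeasure d σ) := by
  have hpi : (0 : ℝ) ≤ 2 * Real.pi := by positivity
  simp only [intervalIntegral.integral_of_le hpi]
  have : SFinite (bergmanMeasure d σ) := by unfold bergmanMeasure hypMeasure; infer_instance
  have hmeas : Measurable (Function.uncurry fun (θ : ℝ) (z : Cd d) => k (R θ z)) :=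
    hm.comp hR.measurable
  have hrot : ∀ θ, Integrable (fun z => k (R θ z)) (bergmanMeasure d σ) := fun θ =>
    (hp θ).integrable_comp_of_integrable hk
  have hint : ∀ {E : Type} [NormedAddCommGroup E] [NormedSpace ℝ E] (h : Cd d → E),
      StronglyMeasurable h → ∀ θ, ∫ z, h (R θ z) ∂(bergmanMeasure d σ)
        = ∫ z, h z ∂(bergmanMeasure d σ) := fun h hh θ => by
    have h2 := integral_map (μ := bergmanMeasure d σ) (hp θ).measurable.aemeasurable (f := h)
      hh.aestronglyMeasurable
    rw [(hp θ).map_eq] at h2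
    exact h2.symm
  have hprod : Integrable (Function.uncurry fun (θ : ℝ) (z : Cd d) => k (R θ z))
      ((volume.restrict (Set.Ioc 0 (2 * Real.pi))).prod (bergmanMeasure d σ)) := by
    rw [integrable_prod_iff hmeas.aestronglyMeasurable]
    refine ⟨.of_forall hrot, ?_⟩
    simp only [Function.uncurry_apply_pair]
    simp_rw [hint (fun z => ‖k z‖) hm.norm.stronglyMeasurable]
    exact integrable_const _
  refine ⟨hprod.integral_prod_right, ?_⟩
  rw [← integral_integral_swap hprod]
  simp_rw [hint k hm.stronglyMeasurable]
  simp [Real.pi_pos.le]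

/-- Rotation by `c` of the orthogonal complement of `e`. -/
noncomputable def partialRot {d : ℕ} (e : Cd d) (c : ℂ) (z : Cd d) : Cd d :=
  ⟪e, z⟫_ℂ • e + c • (z - ⟪e, z⟫_ℂ • e)

theorem norm_sq_partialRot {d : ℕ} {e : Cd d} (he : ‖e‖ = 1) (c : ℂ) (z : Cd d) :
    ‖partialRot e c z‖ ^ 2 = ‖⟪e, z⟫_ℂ‖ ^ 2 + ‖c‖ ^ 2 * ‖z - ⟪e, z⟫_ℂ • e‖ ^ 2 := by
  have h : ⟪⟪e, z⟫_ℂ • e, c • (z - ⟪e, z⟫_ℂ • e)⟫_ℂ = 0 := by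
    rw [inner_smul_left, inner_smul_right, inner_sub_right, inner_smul_right,
      inner_self_eq_norm_sq_to_K, he]
    simp
  have h2 := norm_add_sq_eq_norm_sq_add_norm_sq_of_inner_eq_zero _ _ h
  rw [partialRot, sq, h2, norm_smul, norm_smul, he]
  ring

theorem partialRot_one {d : ℕ} (e z : Cd d) : partialRot e 1 z = z := by
  rw [partialRot, one_smul, add_sub_cancel]

theorem norm_partialRot_le {d : ℕ} {e : Cd d} (he : ‖e‖ = 1) {c : ℂ} (hc : ‖c‖ ≤ 1) (z : Cd d) :
    ‖partialRot e c z‖ ≤ ‖z‖ := by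
  refine (sq_le_sq₀ (norm_nonneg _) (norm_nonneg _)).1 ?_
  conv_rhs => rw [← partialRot_one e z]
  rw [norm_sq_partialRot he, norm_sq_partialRot he, norm_one]
  gcongr

theorem inner_partialRot {d : ℕ} {e : Cd d} (he : ‖e‖ = 1) (c : ℂ) (z : Cd d) :
    ⟪e, partialRot e c z⟫_ℂ = ⟪e, z⟫_ℂ := by
  rw [partialRot, inner_add_right, inner_smul_right, inner_smul_right, inner_sub_right,
    inner_smul_right, inner_self_eq_norm_sq_to_K, he]
  simp

theorem measurePreserving_partialRot {d : ℕ} {e : Cd d} (he : ‖e‖ = 1) (σ θ : ℝ) :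
    MeasurePreserving (partialRot e (expi θ)) (bergmanMeasure d σ) (bergmanMeasure d σ) := by
  let V : Cd d →ₗᵢ[ℝ] Cd d :=
    { toFun := partialRot e (expi θ)
      map_add' := fun x y => by
        simp only [partialRot, inner_add_right, add_smul, smul_sub, smul_add]
        abel
      map_smul' := fun c x => by
        simp only [partialRot, inner_smul_right_eq_smul, smul_assoc, smul_sub, smul_add,
          RingHom.id_apply, smul_comm c]
      norm_map' := fun z => by
        refine (pow_left_inj₀ (norm_nonneg _) (norm_nonneg _) two_ne_zero).1 ?_
        conv_rhs => rw [← partialRot_one e z]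
        change ‖partialRot e (expi θ) z‖ ^ 2 = _
        rw [norm_sq_partialRot he, norm_sq_partialRot he, norm_one, norm_expi] }
  exact measurePreserving_isometry σ (V.toLinearIsometryEquiv rfl)

theorem continuous_partialRot {d : ℕ} (e : Cd d) :
    Continuous (Function.uncurry fun (θ : ℝ) z => partialRot e (expi θ) z) := by
  have := continuous_expi
  unfold partialRot Function.uncurry
  fun_prop

/-- This is the mean value property in the variable `c`: `partialRot e c z` stays in the ball for
`|c| ≤ 1`, depends holomorphically on `c`, and at `c = 0` is the orthogonal projection of `z` to `ℂ
e`. -/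
theorem integral_partialRot {d : ℕ} {e : Cd d} (he : ‖e‖ = 1) {F : Cd d → ℂ} (hF : IsHol F)
    {z : Cd d} (hz : z ∈ unitBall d) :
    ∫ θ in (0 : ℝ)..(2 * Real.pi), F (partialRot e (expi θ) z)
      = 2 * Real.pi * F (⟪e, z⟫_ℂ • e) := by
  have hd : ∀ c ∈ Metric.closedBall (0 : ℂ) 1,
      DifferentiableAt ℂ (fun c => F (partialRot e c z)) c := fun c hc => by
    refine (hF.differentiableAt (mem_unitBall.2 ?_)).comp c ?_
    · exact (norm_partialRot_le he (by simpa using hc) z).trans_lt (mem_unitBall.1 hz)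
    · unfold partialRot
      fun_prop
  have hdc : DiffContOnCl ℂ (fun c => F (partialRot e c z)) (Metric.ball 0 |1|) := by
    rw [abs_one]
    exact DifferentiableOn.diffContOnCl_ball (U := Metric.closedBall 0 1)
      (fun c hc => (hd c hc).differentiableWithinAt) subset_rfl
  have h := hdc.circleAverage
  rw [Real.circleAverage] at h
  have e0 : partialRot e 0 z = ⟪e, z⟫_ℂ • e := by simp [partialRot]
  have e1 : ∀ θ, circleMap 0 1 θ = expi θ := fun θ => by simp [circleMap, expi]
  simp only [e0, e1] at h
  rw [← h, Complex.real_smul, ← mul_assoc]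
  push_cast
  rw [mul_inv_cancel₀ (by simp [Real.pi_ne_zero]), one_mul]

/-! ### The functions `⟨e, z⟩ ^ k` and Taylor coefficients along complex lines -/

/-- The function `⟨e, z⟩ ^ k` on the ball. -/
noncomputable def powFn {d : ℕ} (e : Cd d) (k : ℕ) : Cd d → ℂ :=
  (unitBall d).indicator fun z => ⟪e, z⟫_ℂ ^ k

theorem powFn_apply {d : ℕ} (e : Cd d) (k : ℕ) {z : Cd d} (hz : z ∈ unitBall d) :
    powFn e k z = ⟪e, z⟫_ℂ ^ k := Set.indicator_of_mem hz _

theorem isHol_powFn {d : ℕ} (e : Cd d) (k : ℕ) : IsHol (powFn e k) := by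
  refine ⟨?_, fun z hz => Set.indicator_of_notMem hz _⟩
  have h : AnalyticOnNhd ℂ (fun z : Cd d => ⟪e, z⟫_ℂ ^ k) (unitBall d) := fun z _ =>
    ((innerSL ℂ e).analyticAt z).pow k
  exact h.congr (isOpen_unitBall d) fun z hz => (powFn_apply e k hz).symm

theorem slice_powFn {d : ℕ} (e : Cd d) (k : ℕ) (z : Cd d) :
    Slice (powFn e k) z (Pi.single k (⟪e, z⟫_ℂ ^ k)) := by
  intro ζ hζ
  rw [powFn_apply e k (mem_unitBall.2 hζ), inner_smul_right, mul_pow]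
  have h := hasSum_single (f := fun j => (Pi.single k (⟪e, z⟫_ℂ ^ k) : ℕ → ℂ) j * ζ ^ j) k
    (fun j hj => by simp [Pi.single_eq_of_ne hj])
  simpa [mul_comm] using h

theorem Slice.hasSum_self {d : ℕ} {f : Cd d → ℂ} {z : Cd d} {a : ℕ → ℂ} (h : Slice f z a)
    (hz : z ∈ unitBall d) : HasSum a (f z) := by
  simpa using h 1 (by simpa using mem_unitBall.1 hz)

theorem Slice.iterate {d : ℕ} (j : ℕ) {f : Cd d → ℂ} (hf : IsHol f) {z : Cd d} {a : ℕ → ℂ}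
    (h : Slice f z a) : Slice (Bergman.numberOp^[j] f) z fun k => (k : ℂ) ^ j * a k := by
  induction j generalizing f a with
  | zero => simpa using h
  | succ j ih =>
    have := ih hf.numberOp (h.numberOp hf)
    simp only [← mul_assoc, ← pow_succ] at this
    exact this

theorem iterate_powFn {d : ℕ} (e : Cd d) (j k : ℕ) :
    numberOp^[j] (powFn e k) = ((k : ℂ) ^ j) • powFn e k := by
  funext z
  by_cases hz : z ∈ unitBall d
  · have h1 := ((slice_powFn e k z).iterate j (isHol_powFn e k)).hasSum_self hz
    have h2 := hasSum_single (f := fun i : ℕ => (i : ℂ) ^ j * (Pi.single k (⟪e, z⟫_ℂ ^ k) : ℕ → ℂ) i) k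
      (fun i hi => by simp [Pi.single_eq_of_ne hi])
    rw [h1.unique h2, Pi.single_eq_same, Pi.smul_apply, powFn_apply e k hz, smul_eq_mul]
  · rw [((isHol_powFn e k).iterate j).2 z hz, Pi.smul_apply, (isHol_powFn e k).2 z hz, smul_zero]

theorem shiftProd_powFn {d : ℕ} (α : ℝ) (m : ℕ) (e : Cd d) (k : ℕ) :
    shiftProd α m (powFn e k) = (symb α m k : ℂ) • powFn e k := by
  funext z
  by_cases hz : z ∈ unitBall d
  · have h1 := ((slice_powFn e k z).shiftProd α m (isHol_powFn e k)).hasSum_self hz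
    have h2 := hasSum_single
      (f := fun i => (symb α m i : ℂ) * (Pi.single k (⟪e, z⟫_ℂ ^ k) : ℕ → ℂ) i) k
      (fun i hi => by simp [Pi.single_eq_of_ne hi])
    rw [h1.unique h2, Pi.single_eq_same, Pi.smul_apply, powFn_apply e k hz, smul_eq_mul]
  · rw [((isHol_powFn e k).shiftProd α m).2 z hz, Pi.smul_apply, (isHol_powFn e k).2 z hz,
      smul_zero]

theorem IsHol.memLp_of_bound {d : ℕ} (hd : 1 ≤ d) {σ : ℝ} (hσ : d < σ) {f : Cd d → ℂ}
    (hf : IsHol f) {C : ℝ} (hC : ∀ z ∈ unitBall d, ‖f z‖ ≤ C) :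
    MemLp f 2 (bergmanMeasure d σ) := by
  have := isFiniteMeasure_bergmanMeasure hd hσ
  refine MemLp.of_bound hf.measurable.aestronglyMeasurable C ?_
  filter_upwards [ae_mem_unitBall d σ] with z hz using hC z hz

theorem norm_powFn_le {d : ℕ} {e : Cd d} (he : ‖e‖ = 1) (k : ℕ) :
    ∀ z ∈ unitBall d, ‖powFn e k z‖ ≤ 1 := fun z hz => by
  rw [powFn_apply e k hz, norm_pow]
  refine pow_le_one₀ (norm_nonneg _) ((norm_inner_le_norm e z).trans ?_)
  rw [he, one_mul]
  exact (mem_unitBall.1 hz).le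

theorem powFn_mem {d : ℕ} (hd : 1 ≤ d) {lam : ℝ} {n : ℕ} (hn : (d : ℝ) < lam + 2 * n) {e : Cd d}
    (he : ‖e‖ = 1) (k : ℕ) : powFn e k ∈ sobolevSubmodule d lam n := by
  refine ⟨isHol_powFn e k, fun j _ => ?_⟩
  rw [iterate_powFn]
  exact ((isHol_powFn e k).memLp_of_bound hd hn (norm_powFn_le he k)).const_smul _

/-- Two averages reduce the integral to a moment. Rotating the complement of `e` leaves `⟨e, z⟩^k`
fixed and replaces `F(z)` by `F(⟨e, z⟩ e)`. Rotating all of `z` then keeps only the degree `k` part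
of `F` along the line, leaving `b k |⟨e, z⟩|^(2k)`. -/
theorem integral_conj_powFn_mul {d : ℕ} (hd : 1 ≤ d) {σ : ℝ} (hσ : d < σ) {e : Cd d}
    (he : ‖e‖ = 1) (k : ℕ) {F : Cd d → ℂ} (hF : IsHol F) (hF2 : MemLp F 2 (bergmanMeasure d σ))
    {b : ℕ → ℂ} (hb : Slice F e b) :
    ∫ z, conj (powFn e k z) * F z ∂(bergmanMeasure d σ) = moment σ k * b k := by
  have hpi : (2 * Real.pi : ℂ) ≠ 0 := by simp [Real.pi_ne_zero]
  have hP := isHol_powFn e k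
  have hmP : Measurable fun z => conj (powFn e k z) :=
    (RCLike.continuous_conj (K := ℂ)).measurable.comp hP.measurable
  have hP2 := hP.memLp_of_bound hd hσ (norm_powFn_le he k)
  have hrot : ∀ θ z, expi θ • z ∈ unitBall d ↔ z ∈ unitBall d := fun θ z => by
    simp [mem_unitBall, norm_smul, norm_expi]
  -- averaging over rotations of the orthogonal complement of `e`
  set κ : Cd d → ℂ := fun z => conj (powFn e k z) * F (⟪e, z⟫_ℂ • e) with hκ
  have hκm : Measurable κ := hmP.mul (hF.measurable.comp (by fun_prop))
  have h1 := integral_average (continuous_partialRot e) (measurePreserving_partialRot he σ)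
    (hmP.mul hF.measurable) (integrable_conj_mul hP2 hF2)
  have e1 : ∀ z, ∫ θ in (0 : ℝ)..(2 * Real.pi), conj (powFn e k (partialRot e (expi θ) z)) *
      F (partialRot e (expi θ) z) = 2 * Real.pi * κ z := fun z => by
    by_cases hz : z ∈ unitBall d
    · have h2 : ∀ θ, powFn e k (partialRot e (expi θ) z) = powFn e k z := fun θ => by
        rw [powFn_apply e k hz, powFn_apply, inner_partialRot he]
        exact mem_unitBall.2 ((norm_partialRot_le he (norm_expi θ).le z).trans_lt (mem_unitBall.1 hz))
      simp_rw [h2]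
      rw [intervalIntegral.integral_const_mul, integral_partialRot he hF hz]
      simp only [κ]
      ring
    · have h2 : ∀ θ, partialRot e (expi θ) z ∉ unitBall d := fun θ => by
        have : ‖partialRot e (expi θ) z‖ = ‖z‖ := by
          refine (pow_left_inj₀ (norm_nonneg _) (norm_nonneg _) two_ne_zero).1 ?_
          conv_rhs => rw [← partialRot_one e z]
          rw [norm_sq_partialRot he, norm_sq_partialRot he, norm_one, norm_expi]
        rwa [mem_unitBall, this, ← mem_unitBall]
      simp only [hP.2 _ (h2 _), hP.2 z hz, κ, map_zero, zero_mul, mul_zero,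
        intervalIntegral.integral_zero]
  simp only [Pi.mul_apply] at h1
  simp_rw [e1] at h1
  have hκi : Integrable κ (bergmanMeasure d σ) := by
    have := h1.1.const_mul (2 * Real.pi : ℂ)⁻¹
    simpa only [← mul_assoc, inv_mul_cancel₀ hpi, one_mul] using this
  have h1' := h1.2
  rw [integral_const_mul] at h1'
  rw [← mul_left_cancel₀ hpi h1']
  -- averaging over all rotations
  have h3 := (rotation_average hκm hκi).2
  have e3 : ∀ z ∈ unitBall d, ∫ θ in (0 : ℝ)..(2 * Real.pi), κ (expi θ • z)
      = 2 * Real.pi * (b k * ((‖⟪e, z⟫_ℂ‖ ^ (2 * k) : ℝ) : ℂ)) := fun z hz => by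
    have hζ : ‖⟪e, z⟫_ℂ‖ < 1 := (norm_inner_le_norm e z).trans_lt (by
      rw [he, one_mul]
      exact mem_unitBall.1 hz)
    have hw : ‖⟪e, z⟫_ℂ • e‖ < 1 := by rwa [norm_smul, he, mul_one]
    have hsum : Summable fun j => ‖b j * ⟪e, z⟫_ℂ ^ j‖ := (hb _ hw).summable.norm
    have h4 := hasSum_parseval (F := fun θ => expi θ ^ k)
      (G := fun θ => F (expi θ • ⟪e, z⟫_ℂ • e)) (a := Pi.single k 1)
      (b := fun j => b j * ⟪e, z⟫_ℂ ^ j) (continuous_expi.pow k)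
      (summable_of_ne_finset_zero (s := {k}) fun j hj => by
        simp [Pi.single_eq_of_ne (Finset.notMem_singleton.1 hj)]) hsum
      (fun θ => by
        have := hasSum_single (f := fun j => (Pi.single k (1 : ℂ) : ℕ → ℂ) j * expi θ ^ j) k
          (fun j hj => by simp [Pi.single_eq_of_ne hj])
        simpa using this)
      (fun θ => by
        have := hb (expi θ * ⟪e, z⟫_ℂ) (by rwa [mul_smul, norm_smul, norm_expi, one_mul])
        rw [mul_smul] at this
        refine this.congr_fun fun j => ?_
        rw [mul_pow]
        ring)
    have h5 := hasSum_single (f := fun j => 2 * Real.pi *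
      (conj ((Pi.single k (1 : ℂ) : ℕ → ℂ) j) * (b j * ⟪e, z⟫_ℂ ^ j))) k
      (fun j hj => by simp [Pi.single_eq_of_ne hj])
    have h6 := h4.unique h5
    have e4 : ∀ θ, κ (expi θ • z)
        = conj (⟪e, z⟫_ℂ ^ k) * (conj (expi θ ^ k) * F (expi θ • ⟪e, z⟫_ℂ • e)) := fun θ => by
      simp only [κ]
      rw [powFn_apply e k ((hrot θ z).2 hz), inner_smul_right, mul_pow, map_mul, mul_smul]
      ring
    simp_rw [e4]
    rw [intervalIntegral.integral_const_mul, h6, Pi.single_eq_same, pow_mul]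
    push_cast
    rw [← Complex.conj_mul', map_one, map_pow, mul_pow]
    ring
  rw [integral_congr_ae ((ae_mem_unitBall d σ).mono fun z hz => e3 z hz), integral_const_mul] at h3
  rw [← mul_left_cancel₀ hpi h3, integral_const_mul, integral_complex_ofReal,
    integral_inner_pow hd hσ he, mul_comm]

variable {d : ℕ} {lam : ℝ} {n : ℕ} {hlam : 0 < lam} {hn : (d : ℝ) < lam + 2 * n}

/-- The function `⟨e, z⟩ ^ k` as an element of the generalized Bergman space. -/
noncomputable def powElt (hd : 1 ≤ d) {e : Cd d} (he : ‖e‖ = 1) (k : ℕ) :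
    GenBergman d lam n hlam hn := ⟨powFn e k, powFn_mem hd hn he k⟩

/-- `A` multiplies `⟨e, ·⟩^k` by its eigenvalue and `B` multiplies the `k`-th Taylor coefficient of
`f` by its own; `symb_mul_moment` absorbs both into the moment. -/
theorem inner_powElt (hd : 1 ≤ d) {e : Cd d} (he : ‖e‖ = 1) (k : ℕ)
    (f : GenBergman d lam n hlam hn) {a : ℕ → ℂ} (ha : Slice f e a) :
    ⟪powElt hd he k, f⟫_ℂ = moment lam k * a k := by
  have hf : IsHol f := f.2.1
  rw [inner_def, ← symb_mul_moment hlam n k]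
  change ∫ z, conj (shiftProd (lam + n) n (powFn e k) z) * _ ∂_ = _
  simp only [shiftProd_powFn, Pi.smul_apply, smul_eq_mul, map_mul, Complex.conj_ofReal, mul_assoc]
  rw [integral_const_mul, integral_conj_powFn_mul hd hn he k (hf.shiftProd lam n)
    (memLp_shiftProd lam n hf f.2.2) (ha.shiftProd lam n hf)]
  push_cast
  ring

/-- The sharp bound for point evaluations. -/
theorem norm_apply_sq_le (hd : 1 ≤ d) (f : GenBergman d lam n hlam hn) {z : Cd d}
    (hz : z ∈ unitBall d) : ‖f z‖ ^ 2 ≤ (1 - ‖z‖ ^ 2) ^ (-lam) * ‖f‖ ^ 2 := by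
  obtain ⟨e, t, he, ht, rfl⟩ : ∃ (e : Cd d) (t : ℝ), ‖e‖ = 1 ∧ 0 ≤ t ∧ z = (t : ℂ) • e := by
    by_cases h0 : z = 0
    · exact ⟨EuclideanSpace.single ⟨0, hd⟩ 1, 0, by simp, le_rfl, by simp [h0]⟩
    · have hz0 : (‖z‖ : ℂ) ≠ 0 := by simpa using h0
      refine ⟨(‖z‖ : ℂ)⁻¹ • z, ‖z‖, ?_, norm_nonneg z, ?_⟩
      · rw [norm_smul, norm_inv, Complex.norm_real, norm_norm, inv_mul_cancel₀ (by simpa using h0)]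
      · rw [smul_smul, mul_inv_cancel₀ hz0, one_smul]
  have hf : IsHol f := f.2.1
  have hnorm : ‖(t : ℂ) • e‖ = t := by
    rw [norm_smul, he, mul_one, Complex.norm_real, Real.norm_of_nonneg ht]
  have ht1 : t < 1 := hnorm ▸ mem_unitBall.1 hz
  rw [hnorm]
  obtain ⟨a, ha⟩ := hf.exists_slice e
  have hsum := ha t (mem_unitBall.1 hz)
  have hmom := hasSum_moment hlam (sq_nonneg t) (show t ^ 2 < 1 by nlinarith)
  set K := (1 - t ^ 2) ^ (-lam) with hK
  let u : ℕ → GenBergman d lam n hlam hn := fun k => powElt hd he k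
  -- Partial sums of the reproducing kernel at `t e`. Finite sums suffice, and the kernel itself
  -- need not exist yet: completeness is deduced later from this very bound.
  let g : ℕ → GenBergman d lam n hlam hn := fun m =>
    ∑ k ∈ Finset.range m, ((t ^ k / moment lam k : ℝ) : ℂ) • u k
  have hinner : ∀ m (f : GenBergman d lam n hlam hn) (a : ℕ → ℂ), Slice f e a →
      ⟪g m, f⟫_ℂ = ∑ k ∈ Finset.range m, a k * (t : ℂ) ^ k := fun m f a ha => by
    rw [sum_inner]
    refine Finset.sum_congr rfl fun k _ => ?_
    rw [inner_smul_left, inner_powElt hd he k f ha, Complex.conj_ofReal]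
    have : (moment lam k : ℂ) ≠ 0 := by exact_mod_cast (moment_pos hlam k).ne'
    push_cast
    field_simp
  -- By the reproducing property `hinner` applied to `g m` itself, the squared norm is a partial
  -- sum, with nonnegative terms, of the series for `(1 - t²)^(-λ)`.
  have hg : ∀ m, ‖g m‖ ^ 2 ≤ K := fun m => by
    have h1 : ⟪g m, g m⟫_ℂ = ((∑ k ∈ Finset.range m, (t ^ 2) ^ k / moment lam k : ℝ) : ℂ) := by
      have h0 : ∀ x, ⟪x, g m⟫_ℂ = ∑ k ∈ Finset.range m,
          ((t ^ k / moment lam k : ℝ) : ℂ) * ⟪x, u k⟫_ℂ := fun x => by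
        simp only [g, inner_sum, inner_smul_right]
      rw [h0, Complex.ofReal_sum]
      refine Finset.sum_congr rfl fun k hk => ?_
      rw [hinner m (u k) _ (slice_powFn e k e), inner_self_eq_norm_sq_to_K, he]
      rw [Finset.sum_eq_single_of_mem k hk (fun j _ hj => by simp [Pi.single_eq_of_ne hj])]
      simp only [Pi.single_eq_same]
      push_cast
      simp only [one_pow, one_mul]
      ring
    rw [← inner_self_eq_norm_sq (𝕜 := ℂ), h1, RCLike.re_to_complex, Complex.ofReal_re]
    refine sum_le_hasSum _ (fun k _ => ?_) hmom
    have := moment_pos hlam k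
    positivity
  have hlim : Filter.Tendsto (fun m => ‖⟪g m, f⟫_ℂ‖ ^ 2) Filter.atTop
      (nhds (‖f ((t : ℂ) • e)‖ ^ 2)) := by
    simp_rw [fun m => hinner m f a ha]
    exact (hsum.tendsto_sum_nat.norm).pow 2
  refine le_of_tendsto' hlim fun m => ?_
  calc ‖⟪g m, f⟫_ℂ‖ ^ 2 ≤ (‖g m‖ * ‖f‖) ^ 2 := by
        gcongr
        exact norm_inner_le_norm _ _
    _ = ‖g m‖ ^ 2 * ‖f‖ ^ 2 := by ring
    _ ≤ K * ‖f‖ ^ 2 := by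
        gcongr
        exact hg m

/-! ### Bounded functions separate points -/

/-- The dilation `z ↦ f (ρ z)` on the ball. -/
noncomputable def dil {d : ℕ} (ρ : ℝ) (f : Cd d → ℂ) : Cd d → ℂ :=
  (unitBall d).indicator fun z => f ((ρ : ℂ) • z)

theorem dil_apply {d : ℕ} (ρ : ℝ) (f : Cd d → ℂ) {z : Cd d} (hz : z ∈ unitBall d) :
    dil ρ f z = f ((ρ : ℂ) • z) := Set.indicator_of_mem hz _

theorem norm_ofReal_smul {d : ℕ} {ρ : ℝ} (h : 0 ≤ ρ) (z : Cd d) : ‖(ρ : ℂ) • z‖ = ρ * ‖z‖ := by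
  rw [norm_smul, Complex.norm_real, Real.norm_of_nonneg h]

theorem IsHol.dil {d : ℕ} {ρ : ℝ} (h0 : 0 ≤ ρ) (h1 : ρ < 1) {f : Cd d → ℂ} (hf : IsHol f) :
    IsHol (dil ρ f) := by
  refine ⟨?_, fun z hz => Set.indicator_of_notMem hz _⟩
  have h : AnalyticOnNhd ℂ (fun z => f ((ρ : ℂ) • z)) (unitBall d) := fun z hz => by
    refine (hf.1 _ (mem_unitBall.2 ?_)).comp_of_eq (f := fun z => (ρ : ℂ) • z) ?_ rfl
    · rw [norm_ofReal_smul h0]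
      have := mem_unitBall.1 hz
      nlinarith [norm_nonneg z]
    · exact ((ρ : ℂ) • ContinuousLinearMap.id ℂ (Cd d)).analyticAt z
  exact h.congr (isOpen_unitBall d) fun z hz => (dil_apply ρ f hz).symm

theorem Slice.dil {d : ℕ} {ρ : ℝ} (h0 : 0 ≤ ρ) (h1 : ρ < 1) {f : Cd d → ℂ} {z : Cd d} {a : ℕ → ℂ}
    (h : Slice f z a) : Slice (dil ρ f) z fun k => (ρ : ℂ) ^ k * a k := by
  intro ζ hζ
  have h2 : ‖(ρ * ζ : ℂ) • z‖ < 1 := by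
    rw [mul_smul, norm_ofReal_smul h0]
    nlinarith [norm_nonneg (ζ • z)]
  rw [dil_apply _ _ (mem_unitBall.2 hζ), smul_smul]
  refine (h _ h2).congr_fun fun k => ?_
  rw [mul_pow]
  ring

/-- Both operators act diagonally on the homogeneous parts, by `k^j` and by `ρ^k`, so they commute.
-/
theorem iterate_dil {d : ℕ} {ρ : ℝ} (h0 : 0 ≤ ρ) (h1 : ρ < 1) {f : Cd d → ℂ} (hf : IsHol f) (j : ℕ) :
    numberOp^[j] (dil ρ f) = dil ρ (numberOp^[j] f) := by
  funext z
  by_cases hz : z ∈ unitBall d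
  · obtain ⟨a, ha⟩ := hf.exists_slice z
    have e1 := ((ha.dil h0 h1).iterate j (hf.dil h0 h1)).hasSum_self hz
    have e2 := ((ha.iterate j hf).dil h0 h1).hasSum_self hz
    refine e1.unique (e2.congr_fun fun k => ?_)
    ring
  · rw [((hf.dil h0 h1).iterate j).2 z hz, ((hf.iterate j).dil h0 h1).2 z hz]

theorem exists_bound_dil {d : ℕ} {ρ : ℝ} (h0 : 0 ≤ ρ) (h1 : ρ < 1) {f : Cd d → ℂ} (hf : IsHol f) :
    ∃ C, ∀ z ∈ unitBall d, ‖dil ρ f z‖ ≤ C := by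
  have hsub : Metric.closedBall (0 : Cd d) ρ ⊆ unitBall d := fun z hz => mem_unitBall.2 <| by
    rw [mem_closedBall_zero_iff] at hz
    exact hz.trans_lt h1
  obtain ⟨C, hC⟩ := (isCompact_closedBall (0 : Cd d) ρ).exists_bound_of_continuousOn
    ((continuousOn_of_isHol hf).mono hsub)
  refine ⟨C, fun z hz => ?_⟩
  rw [dil_apply _ _ hz]
  refine hC _ ?_
  rw [mem_closedBall_zero_iff, norm_ofReal_smul h0]
  exact mul_le_of_le_one_right h0 (mem_unitBall.1 hz).le

theorem dil_mem {d : ℕ} (hd : 1 ≤ d) {lam : ℝ} {n : ℕ} (hn : (d : ℝ) < lam + 2 * n) {ρ : ℝ}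
    (h0 : 0 ≤ ρ) (h1 : ρ < 1) {f : Cd d → ℂ} (hf : IsHol f) : dil ρ f ∈ sobolevSubmodule d lam n := by
  refine ⟨hf.dil h0 h1, fun j _ => ?_⟩
  rw [iterate_dil h0 h1 hf]
  obtain ⟨C, hC⟩ := exists_bound_dil h0 h1 (hf.iterate j)
  exact ((hf.iterate j).dil h0 h1).memLp_of_bound hd hn hC

/-- A factor `ρ^(2k)` on one side equals `ρ^k` on each side. After integration this reads `⟨f_{ρ²},
f⟩ = ‖f_ρ‖²`. -/
theorem circ_dil {d : ℕ} {ρ : ℝ} (h0 : 0 ≤ ρ) (h1 : ρ < 1) (α β : ℝ) (m : ℕ) {f : Cd d → ℂ}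
    (hf : IsHol f) : circ α β m (dil (ρ ^ 2) f) f = circ α β m (dil ρ f) (dil ρ f) := by
  have h2 : ρ ^ 2 < 1 := by nlinarith
  funext z
  by_cases hz : z ∈ unitBall d
  · obtain ⟨a, ha⟩ := hf.exists_slice z
    have e1 := hasSum_circ α β m (hf.dil (sq_nonneg ρ) h2) hf hz (ha.dil (sq_nonneg ρ) h2) ha
    have e2 := hasSum_circ α β m (hf.dil h0 h1) (hf.dil h0 h1) hz (ha.dil h0 h1) (ha.dil h0 h1)
    refine e1.unique (e2.congr_fun fun k => ?_)
    simp only [map_mul, map_pow, Complex.conj_ofReal]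
    push_cast
    ring
  · rw [circ_of_notMem α β m (hf.dil (sq_nonneg ρ) h2) hz, circ_of_notMem α β m (hf.dil h0 h1) hz]

theorem two_pi_mul_inner (f g : GenBergman d lam n hlam hn) :
    2 * Real.pi * ⟪f, g⟫_ℂ
      = ∫ z, circ (lam + n) lam n f.1 g.1 z ∂(bergmanMeasure d (lam + 2 * n)) :=
  (circ_integral (lam + n) lam n f.2.1 g.2.1 f.2.2 g.2.2).2.symm

/-- The bounded element `dil (ρ ^ 2) f` is tested against `f`; by `circ_dil` every dilation `dil ρ
f` then has norm zero. No density theorem is needed. -/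
theorem eq_zero_of_inner_bounded (hd : 1 ≤ d) (f : GenBergman d lam n hlam hn)
    (h : ∀ g : GenBergman d lam n hlam hn, (∃ C, ∀ z ∈ unitBall d, ‖g z‖ ≤ C) → ⟪g, f⟫_ℂ = 0) :
    f = 0 := by
  have hf : IsHol f := f.2.1
  have hdil : ∀ ρ : ℝ, 0 ≤ ρ → ρ < 1 → dil ρ f = 0 := by
    intro ρ h0 h1
    have h2 : ρ ^ 2 < 1 := by nlinarith
    let g : GenBergman d lam n hlam hn := ⟨dil ρ f, dil_mem hd hn h0 h1 hf⟩
    let g2 : GenBergman d lam n hlam hn := ⟨dil (ρ ^ 2) f, dil_mem hd hn (sq_nonneg ρ) h2 hf⟩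
    have e1 := two_pi_mul_inner g2 f
    have e2 := two_pi_mul_inner g g
    change _ = ∫ z, circ (lam + n) lam n (dil (ρ ^ 2) f) f z ∂_ at e1
    change _ = ∫ z, circ (lam + n) lam n (dil ρ f) (dil ρ f) z ∂_ at e2
    rw [circ_dil h0 h1 _ _ _ hf, ← e2, h g2 (exists_bound_dil (sq_nonneg ρ) h2 hf), mul_zero] at e1
    have hpi : (2 * Real.pi : ℂ) ≠ 0 := by simp [Real.pi_ne_zero]
    have hg : g = 0 := inner_self_eq_zero.1 ((mul_eq_zero.1 e1.symm).resolve_left hpi)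
    exact congrArg Subtype.val hg
  refine Subtype.ext (funext fun z => ?_)
  change f z = 0
  by_cases hz : z ∈ unitBall d
  -- With `|z| < ρ < 1`, the value `f z` is that of the vanishing dilation at the point `ρ⁻¹ z` of
  -- the ball.
  · obtain ⟨ρ, hρ, hρ1⟩ := exists_between (mem_unitBall.1 hz)
    have h0 : 0 < ρ := (norm_nonneg z).trans_lt hρ
    have hw : ((ρ⁻¹ : ℝ) : ℂ) • z ∈ unitBall d := by
      rw [mem_unitBall, norm_ofReal_smul (by positivity), inv_mul_lt_iff₀ h0, mul_one]
      exact hρ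
    have := congrFun (hdil ρ h0.le hρ1) (((ρ⁻¹ : ℝ) : ℂ) • z)
    rw [dil_apply _ _ hw, smul_smul, ← Complex.ofReal_mul, mul_inv_cancel₀ h0.ne',
      Complex.ofReal_one, one_smul] at this
    exact this
  · exact hf.2 z hz

/-! ### Completeness -/

/-- Each factor of `symb` satisfies `k ≤ M (1 + k / (a + i))`, because `a + i ≤ M`. The case `k = 0`
is separate, since raising the exponent from `j` to `n` needs `k ≥ 1`. -/
theorem natCast_pow_le_symb {a : ℝ} (ha : 0 < a) {n j k : ℕ} (hj : j ≤ n) {M : ℝ} (hM1 : 1 ≤ M)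
    (hM : a + n ≤ M) : (k : ℝ) ^ j ≤ M ^ n * symb a n k := by
  rcases Nat.eq_zero_or_pos k with rfl | hk
  · have h1 : (((0 : ℕ) : ℝ)) ^ j ≤ 1 := by
      rw [Nat.cast_zero]
      exact pow_le_one₀ le_rfl zero_le_one
    have h2 := one_le_symb ha n 0
    have h3 : 1 ≤ M ^ n := one_le_pow₀ hM1
    nlinarith
  · have hk1 : (1 : ℝ) ≤ k := by exact_mod_cast hk
    refine (pow_le_pow_right₀ hk1 hj).trans ?_
    have h : (k : ℝ) ^ n = ∏ _i ∈ Finset.range n, (k : ℝ) := by simp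
    have h' : M ^ n = ∏ _i ∈ Finset.range n, M := by simp
    rw [symb, h, h', ← Finset.prod_mul_distrib]
    refine Finset.prod_le_prod (fun i _ => by positivity) fun i hi => ?_
    have hi' : (i : ℝ) ≤ n := by exact_mod_cast (Finset.mem_range.1 hi).le
    have h0 : 0 < a + i := by positivity
    have h2 : k ≤ M * (k / (a + i)) := by
      rw [← mul_div_assoc, le_div_iff₀ h0, mul_comm M]
      gcongr
      linarith
    linarith

/-- Compared coefficient by coefficient. The constant `λ + 2n + 1` dominates `a + n` for both `a =
λ` and `a = λ + n`, and is at least `1`; integrated, the estimate bounds every `N^j f` in `L²` by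
the norm of `f`. -/
theorem circ_iterate_le (hlam : 0 < lam) {j : ℕ} (hj : j ≤ n) {f : Cd d → ℂ}
    (hf : IsHol f) (z : Cd d) :
    (circ (lam + n) lam 0 (numberOp^[j] f) (numberOp^[j] f) z).re
      ≤ (lam + 2 * n + 1) ^ (2 * n) * (circ (lam + n) lam n f f z).re := by
  have hln : 0 < lam + n := by positivity
  have hn0 : (0 : ℝ) ≤ n := Nat.cast_nonneg n
  by_cases hz : z ∈ unitBall d
  · obtain ⟨a, ha⟩ := hf.exists_slice z
    have h0 := Complex.hasSum_re (hasSum_circ (lam + n) lam 0 (hf.iterate j) (hf.iterate j) hz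
      (ha.iterate j hf) (ha.iterate j hf))
    have h1 := (Complex.hasSum_re (hasSum_circ (lam + n) lam n hf hf hz ha ha)).mul_left
      ((lam + 2 * n + 1) ^ (2 * n))
    have e : ∀ b : ℂ, (conj b * b) = ((‖b‖ ^ 2 : ℝ) : ℂ) := fun b => by
      rw [Complex.conj_mul']
      push_cast
      rfl
    simp only [e, ← Complex.ofReal_mul, Complex.ofReal_re, norm_mul, norm_pow,
      Complex.norm_natCast] at h0 h1
    have s0 : ∀ (a : ℝ) (k : ℕ), symb a 0 k = 1 := fun a k => by simp [symb]
    simp only [s0] at h0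
    refine hasSum_le (fun k => ?_) h0 h1
    have b1 := natCast_pow_le_symb hln (k := k) hj (M := lam + 2 * n + 1) (by linarith) (by linarith)
    have b2 := natCast_pow_le_symb hlam (k := k) hj (M := lam + 2 * n + 1) (by linarith) (by linarith)
    have b3 := mul_le_mul b1 b2 (by positivity) (le_trans (by positivity) b1)
    calc 2 * Real.pi * (1 * 1) * ((k : ℝ) ^ j * ‖a k‖) ^ 2
        = 2 * Real.pi * ‖a k‖ ^ 2 * ((k : ℝ) ^ j * (k : ℝ) ^ j) := by ring
      _ ≤ 2 * Real.pi * ‖a k‖ ^ 2 * ((lam + 2 * n + 1) ^ n * symb (lam + n) n k *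
          ((lam + 2 * n + 1) ^ n * symb lam n k)) := by
        have := Real.pi_pos
        gcongr
      _ = _ := by ring
  · simp [circ_of_notMem _ _ _ hf hz, circ_of_notMem _ _ _ (hf.iterate j) hz]

theorem integral_iterate_le {j : ℕ} (hj : j ≤ n) (f : GenBergman d lam n hlam hn) :
    ∫ z, ‖(numberOp^[j] f.1) z‖ ^ 2 ∂(bergmanMeasure d (lam + 2 * n))
      ≤ (lam + 2 * n + 1) ^ (2 * n) * ‖f‖ ^ 2 := by
  have hf : IsHol f := f.2.1
  have h1 := circ_integral (lam + n) lam n hf hf f.2.2 f.2.2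
  have hm : ∀ k ≤ 0, MemLp (numberOp^[k] (numberOp^[j] f.1)) 2 (bergmanMeasure d (lam + 2 * n)) :=
    fun k hk => by
      obtain rfl : k = 0 := by omega
      exact f.2.2 j hj
  have h0 := circ_integral (lam + n) lam 0 (hf.iterate j) (hf.iterate j) hm hm
  have hle := integral_mono h0.1.re (h1.1.re.const_mul ((lam + 2 * n + 1) ^ (2 * n)))
    fun z => circ_iterate_le hlam hj hf z
  rw [integral_const_mul] at hle
  have e0 := integral_re h0.1
  have e1 := integral_re h1.1
  simp only [RCLike.re_to_complex] at e0 e1 hle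
  rw [e0, e1, h0.2, h1.2] at hle
  have hre : ∀ w : ℂ, ((2 : ℂ) * Real.pi * w).re = 2 * Real.pi * w.re := fun w => by simp
  rw [hre, hre, mul_left_comm] at hle
  have hle' := le_of_mul_le_mul_left hle (by positivity)
  have en : ‖f‖ ^ 2 = (∫ z, conj (shiftProd (lam + n) n f.1 z) * shiftProd lam n f.1 z
      ∂(bergmanMeasure d (lam + 2 * n))).re := by
    rw [← inner_self_eq_norm_sq (𝕜 := ℂ), inner_def]
    rfl
  rw [en]
  refine le_trans (le_of_eq ?_) hle'
  have e : ∀ z, conj (shiftProd (lam + n) 0 (numberOp^[j] f.1) z) *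
      shiftProd lam 0 (numberOp^[j] f.1) z = ((‖(numberOp^[j] f.1) z‖ ^ 2 : ℝ) : ℂ) := fun z => by
    simp only [shiftProd]
    rw [Complex.conj_mul']
    push_cast
    rfl
  simp_rw [e]
  rw [integral_complex_ofReal, Complex.ofReal_re]

theorem eLpNorm_iterate_le {j : ℕ} (hj : j ≤ n) (f : GenBergman d lam n hlam hn) :
    eLpNorm (numberOp^[j] f.1) 2 (bergmanMeasure d (lam + 2 * n))
      ≤ ENNReal.ofReal ((lam + 2 * n + 1) ^ n * ‖f‖) := by
  rw [(f.2.2 j hj).eLpNorm_eq_integral_rpow_norm two_ne_zero ENNReal.ofNat_ne_top]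
  refine ENNReal.ofReal_le_ofReal ?_
  simp only [ENNReal.toReal_ofNat, Real.rpow_ofNat]
  rw [← one_div, ← Real.sqrt_eq_rpow]
  refine Real.sqrt_le_iff.2 ⟨by positivity, (integral_iterate_le hj f).trans (le_of_eq ?_)⟩
  ring

theorem exists_eLpNorm_shiftProd_le {μ : Measure (Cd d)} (a : ℝ) (m : ℕ) : ∃ K : ℝ, 0 ≤ K ∧
    ∀ (f : Cd d → ℂ) (δ : ℝ), IsHol f → 0 ≤ δ →
      (∀ k ≤ m, eLpNorm (numberOp^[k] f) 2 μ ≤ ENNReal.ofReal δ) →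
        eLpNorm (shiftProd a m f) 2 μ ≤ ENNReal.ofReal (K * δ) := by
  induction m with
  | zero => exact ⟨1, zero_le_one, fun f δ _ _ h => by simpa [shiftProd] using h 0 le_rfl⟩
  | succ m ih =>
    obtain ⟨K, hK, ih⟩ := ih
    refine ⟨K * (1 + ‖((a + m : ℝ) : ℂ)⁻¹‖), by positivity, fun f δ hf hδ h => ?_⟩
    rw [mul_assoc]
    refine ih (shiftOp (a + m) f) _ (hf.shiftOp _) (by positivity) fun k hk => ?_
    rw [shiftOp, iterate_add k hf (hf.numberOp.smul _), iterate_smul k _ hf.numberOp,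
      ← Function.iterate_succ_apply, add_mul, one_mul, ENNReal.ofReal_add hδ (by positivity)]
    have h1 : eLpNorm (((a + m : ℝ) : ℂ)⁻¹ • numberOp^[k + 1] f) 2 μ
        ≤ ENNReal.ofReal (‖((a + m : ℝ) : ℂ)⁻¹‖ * δ) := by
      refine (eLpNorm_const_smul_le).trans ?_
      rw [ENNReal.ofReal_mul (norm_nonneg _), ofReal_norm]
      gcongr
      exact h (k + 1) (by omega)
    exact (eLpNorm_add_le (hf.iterate k).measurable.aestronglyMeasurable
      (((hf.iterate (k + 1)).measurable.aestronglyMeasurable).const_smul _) one_le_two).trans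
      (add_le_add (h k (by omega)) h1)

/-- Together with `eLpNorm_iterate_le`, this makes the norm equivalent to the Sobolev norm given by
the `L²` norms of `N^k f`, `k ≤ n`, which suits limits better than the form `⟨A f, B f⟩`. -/
theorem exists_norm_sq_le (d : ℕ) (lam : ℝ) (n : ℕ) (hlam : 0 < lam) (hn : (d : ℝ) < lam + 2 * n) :
    ∃ K : ℝ, 0 ≤ K ∧ ∀ (f : GenBergman d lam n hlam hn) (δ : ℝ), 0 ≤ δ →
      (∀ k ≤ n, eLpNorm (numberOp^[k] f.1) 2 (bergmanMeasure d (lam + 2 * n)) ≤ ENNReal.ofReal δ) →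
        ‖f‖ ^ 2 ≤ K * δ ^ 2 := by
  obtain ⟨K1, hK1, h1⟩ := exists_eLpNorm_shiftProd_le (μ := bergmanMeasure d (lam + 2 * n))
    (lam + n) n
  obtain ⟨K2, hK2, h2⟩ := exists_eLpNorm_shiftProd_le (μ := bergmanMeasure d (lam + 2 * n)) lam n
  refine ⟨K1 * K2, by positivity, fun f δ hδ h => ?_⟩
  have hf : IsHol f := f.2.1
  have hA := memLp_shiftProd (lam + n) n hf f.2.2
  have hB := memLp_shiftProd lam n hf f.2.2
  have e1 : ‖⟪f, f⟫_ℂ‖ₑ ≤ ENNReal.ofReal (K1 * K2 * δ ^ 2) := by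
    rw [inner_def]
    refine (enorm_integral_le_lintegral_enorm _).trans ?_
    rw [← eLpNorm_one_eq_lintegral_enorm]
    have h3 := eLpNorm_smul_le_mul_eLpNorm (p := 2) (q := 2) (r := 1)
      hB.1 hA.star.1
    refine h3.trans ?_
    rw [show K1 * K2 * δ ^ 2 = (K1 * δ) * (K2 * δ) by ring, ENNReal.ofReal_mul (by positivity)]
    gcongr
    · refine le_trans (le_of_eq ?_) (h1 f δ hf hδ h)
      exact eLpNorm_congr_norm_ae (.of_forall fun z => by simp)
    · exact h2 f δ hf hδ h
  rw [inner_self_eq_norm_sq_to_K, ← ofReal_norm] at e1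
  rw [ENNReal.ofReal_le_ofReal_iff (by positivity)] at e1
  simpa using e1

theorem norm_apply_le_of_norm_le (hd : 1 ≤ d) (f : GenBergman d lam n hlam hn) {r : ℝ} (hr : r < 1)
    {z : Cd d} (hz : ‖z‖ ≤ r) : ‖f z‖ ≤ √((1 - r ^ 2) ^ (-lam)) * ‖f‖ := by
  have h := norm_apply_sq_le hd f (mem_unitBall.2 (hz.trans_lt hr))
  have hr0 : 0 ≤ r := (norm_nonneg z).trans hz
  have h1 : 0 < 1 - r ^ 2 := by nlinarith
  have h2 : 1 - r ^ 2 ≤ 1 - ‖z‖ ^ 2 := by gcongr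
  have h3 : (1 - ‖z‖ ^ 2) ^ (-lam) ≤ (1 - r ^ 2) ^ (-lam) :=
    Real.rpow_le_rpow_of_nonpos h1 h2 (by linarith)
  refine (sq_le_sq₀ (norm_nonneg _) (by positivity)).1 ?_
  rw [mul_pow, Real.sq_sqrt (by positivity)]
  exact h.trans (by gcongr)

/-! ### Locally uniform limits and Fatou's lemma -/

/-- Uniform convergence to `0` on all balls of radius less than `1`. -/
def TendstoLocally (h : ℕ → Cd d → ℂ) : Prop :=
  ∀ r < 1, ∀ ε > 0, ∃ N, ∀ m ≥ N, ∀ z : Cd d, ‖z‖ < r → ‖h m z‖ ≤ ε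

theorem TendstoLocally.numberOp {h : ℕ → Cd d → ℂ} (hh : ∀ m, IsHol (h m))
    (hl : TendstoLocally h) : TendstoLocally fun m => numberOp (h m) := by
  intro r hr ε hε
  obtain ⟨r', hrr', hr'⟩ := exists_between hr
  have hR : 0 < r' - r := sub_pos.2 hrr'
  -- The Cauchy estimate on a ball of radius `r' - r` involves an oscillation of at most twice this
  -- tolerance, so the derivative is bounded by `ε`.
  obtain ⟨N, hN⟩ := hl r' hr' (ε * (r' - r) / 2) (by positivity)
  refine ⟨N, fun m hm z hz => ?_⟩
  have hz1 : z ∈ unitBall d := mem_unitBall.2 (hz.trans hr)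
  have hsub : ∀ w ∈ Metric.ball z (r' - r), ‖w‖ < r' := fun w hw => by
    have h1 := norm_le_norm_add_norm_sub' w z
    rw [← dist_eq_norm] at h1
    have := Metric.mem_ball.1 hw
    linarith
  have hd : DifferentiableOn ℂ (h m) (Metric.ball z (r' - r)) := fun w hw =>
    ((hh m).differentiableAt (mem_unitBall.2 ((hsub w hw).trans hr'))).differentiableWithinAt
  have hmaps : Set.MapsTo (h m) (Metric.ball z (r' - r))
      (Metric.closedBall (h m z) (ε * (r' - r))) := fun w hw => by
    rw [Metric.mem_closedBall, dist_eq_norm]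
    have h1 := hN m hm w (hsub w hw)
    have h2 := hN m hm z (hz.trans hrr')
    linarith [norm_sub_le (h m w) (h m z)]
  have h3 := Complex.norm_fderiv_le_div_of_mapsTo_ball hd hmaps hR
  rw [mul_div_cancel_right₀ _ hR.ne'] at h3
  change ‖Bergman.numberOp (h m) z‖ ≤ ε
  rw [numberOp_apply _ hz1]
  refine ((fderiv ℂ (h m) z).le_opNorm z).trans ?_
  have := (hz.trans hr).le
  calc _ ≤ ε * 1 := by gcongr
    _ = ε := mul_one ε

theorem TendstoLocally.iterate {h : ℕ → Cd d → ℂ} (hh : ∀ m, IsHol (h m))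
    (hl : TendstoLocally h) (j : ℕ) : TendstoLocally fun m => Bergman.numberOp^[j] (h m) := by
  induction j generalizing h with
  | zero => exact hl
  | succ j ih => exact ih (fun m => (hh m).numberOp) (hl.numberOp hh)

theorem TendstoLocally.tendsto {h : ℕ → Cd d → ℂ} (hl : TendstoLocally h) {z : Cd d}
    (hz : z ∈ unitBall d) : Filter.Tendsto (fun m => h m z) Filter.atTop (nhds 0) := by
  obtain ⟨r, hzr, hr⟩ := exists_between (mem_unitBall.1 hz)
  rw [Metric.tendsto_atTop]
  intro ε hε
  obtain ⟨N, hN⟩ := hl r hr (ε / 2) (by positivity)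
  refine ⟨N, fun m hm => ?_⟩
  rw [dist_zero_right]
  linarith [hN m hm z hzr]

theorem iterate_sub (k : ℕ) {f g : Cd d → ℂ} (hf : IsHol f) (hg : IsHol g) :
    numberOp^[k] (f - g) = numberOp^[k] f - numberOp^[k] g := by
  have h := iterate_add k hf (hg.smul (-1))
  rw [iterate_smul k _ hg] at h
  simpa only [neg_smul, one_smul, ← sub_eq_add_neg] using h

theorem IsHol.sub {f g : Cd d → ℂ} (hf : IsHol f) (hg : IsHol g) : IsHol (f - g) := by
  simpa only [neg_smul, one_smul, ← sub_eq_add_neg] using hf.add (hg.smul (-1))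

/-- The kernel bound is uniform on `|z| ≤ r < 1`, so a Cauchy sequence in norm is uniformly Cauchy
there, and its limit is analytic by `analyticAt_of_tendstoUniformlyOn`. -/
theorem exists_limit (hd : 1 ≤ d) {u : ℕ → GenBergman d lam n hlam hn} (hu : CauchySeq u) :
    ∃ F : Cd d → ℂ, IsHol F ∧ TendstoLocally fun m => (u m).1 - F := by
  rw [Metric.cauchySeq_iff] at hu
  have key : ∀ r < 1, ∀ ε > 0, ∃ N, ∀ m ≥ N, ∀ l ≥ N, ∀ z : Cd d, ‖z‖ < r →
      ‖u m z - u l z‖ ≤ ε := by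
    intro r hr ε hε
    set K := √((1 - r ^ 2) ^ (-lam))
    have hK : 0 ≤ K := Real.sqrt_nonneg _
    obtain ⟨N, hN⟩ := hu (ε / (K + 1)) (by positivity)
    refine ⟨N, fun m hm l hl z hz => ?_⟩
    have h1 := norm_apply_le_of_norm_le hd (u m - u l) hr hz.le
    have h2 := hN m hm l hl
    rw [dist_eq_norm] at h2
    refine h1.trans ?_
    calc K * ‖u m - u l‖ ≤ K * (ε / (K + 1)) := by gcongr
      _ ≤ (K + 1) * (ε / (K + 1)) := by
        gcongr
        linarith
      _ = ε := by field_simp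
  have hpt : ∀ z, ∃ w, Filter.Tendsto (fun m => u m z) Filter.atTop (nhds w) := by
    intro z
    by_cases hz : z ∈ unitBall d
    · obtain ⟨r, hzr, hr⟩ := exists_between (mem_unitBall.1 hz)
      refine cauchySeq_tendsto_of_complete (Metric.cauchySeq_iff.2 fun ε hε => ?_)
      obtain ⟨N, hN⟩ := key r hr (ε / 2) (by positivity)
      refine ⟨N, fun m hm l hl => ?_⟩
      rw [dist_eq_norm]
      linarith [hN m hm l hl z hzr]
    · exact ⟨0, tendsto_const_nhds.congr fun m => ((u m).2.1.2 z hz).symm⟩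
  choose F hF using hpt
  have hloc : TendstoLocally fun m => (u m).1 - F := by
    intro r hr ε hε
    obtain ⟨N, hN⟩ := key r hr ε hε
    refine ⟨N, fun m hm z hz => ?_⟩
    refine le_of_tendsto ((tendsto_const_nhds.sub (hF z)).norm) ?_
    filter_upwards [Filter.eventually_ge_atTop N] with l hl
    exact hN m hm l hl z hz
  refine ⟨F, ⟨fun c hc => ?_, fun z hz => ?_⟩, hloc⟩
  · have hc1 := mem_unitBall.1 hc
    obtain ⟨r, hcr, hr⟩ := exists_between hc1
    have hR : 0 < r - ‖c‖ := sub_pos.2 hcr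
    have hsub : ∀ w ∈ Metric.ball c (r - ‖c‖), ‖w‖ < r := fun w hw => by
      have h1 := norm_le_norm_add_norm_sub' w c
      rw [← dist_eq_norm] at h1
      have := Metric.mem_ball.1 hw
      linarith
    refine analyticAt_of_tendstoUniformlyOn (f := fun m => (u m).1) hR (fun m w hw =>
      (u m).2.1.1 w (mem_unitBall.2 ((hsub w hw).trans hr))) (fun m => ?_) ?_
    · exact ⟨_, fun w hw => norm_apply_le_of_norm_le hd (u m) hr (hsub w hw).le⟩
    · rw [Metric.tendstoUniformlyOn_iff]
      intro ε hε
      obtain ⟨N, hN⟩ := hloc r hr (ε / 2) (by positivity)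
      filter_upwards [Filter.eventually_ge_atTop N] with m hm w hw
      have h1 := hN m hm w (hsub w hw)
      rw [dist_comm, dist_eq_norm]
      exact h1.trans_lt (half_lt_self hε)
  · exact tendsto_nhds_unique (hF z)
      (tendsto_const_nhds.congr fun m => ((u m).2.1.2 z hz).symm)

theorem completeSpace_genBergman (hd : 1 ≤ d) : CompleteSpace (GenBergman d lam n hlam hn) := by
  refine Metric.complete_of_cauchySeq_tendsto fun u hu => ?_
  obtain ⟨F, hF, hloc⟩ := exists_limit hd hu
  set μ := bergmanMeasure d (lam + 2 * n)
  set M := (lam + 2 * n + 1) ^ n with hM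
  have hM0 : 0 < M := by positivity
  have hsub : ∀ m, IsHol ((u m).1 - F) := fun m => IsHol.sub (u m).2.1 hF
  -- For fixed `m`, the functions `N^j (u m - u l)` converge to `N^j (u m - F)` at each point of the
  -- ball as `l → ∞`, and their `L²` norms are at most `M ε`; Fatou's lemma passes the bound to the
  -- limit.
  have hfatou : ∀ ε > 0, ∃ N, ∀ m ≥ N, ∀ j ≤ n,
      eLpNorm (numberOp^[j] ((u m).1 - F)) 2 μ ≤ ENNReal.ofReal (M * ε) := by
    intro ε hε
    obtain ⟨N, hN⟩ := Metric.cauchySeq_iff.1 hu ε hε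
    refine ⟨N, fun m hm j hj => ?_⟩
    have h1 : ∀ᵐ z ∂μ, Filter.Tendsto (fun l => (numberOp^[j] ((u m).1 - (u l).1)) z) Filter.atTop
        (nhds ((numberOp^[j] ((u m).1 - F)) z)) := by
      filter_upwards [ae_mem_unitBall d _] with z hz
      have h2 := (hloc.iterate hsub j).tendsto hz
      have h3 := (tendsto_const_nhds (x := (numberOp^[j] ((u m).1 - F)) z)).sub h2
      rw [sub_zero] at h3
      refine h3.congr fun l => ?_
      have := iterate_sub j (hsub m) (hsub l)
      rw [sub_sub_sub_cancel_right] at this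
      rw [this]
      rfl
    refine (Lp.eLpNorm_lim_le_liminf_eLpNorm (fun l =>
      ((IsHol.sub (u m).2.1 (u l).2.1).iterate j).measurable.aestronglyMeasurable) _ h1).trans ?_
    refine Filter.liminf_le_of_frequently_le' (Filter.Eventually.frequently ?_)
    filter_upwards [Filter.eventually_ge_atTop N] with l hl
    refine (eLpNorm_iterate_le hj (u m - u l)).trans (ENNReal.ofReal_le_ofReal ?_)
    have := hN m hm l hl
    rw [dist_eq_norm] at this
    gcongr
  have hFmem : F ∈ sobolevSubmodule d lam n := by
    refine ⟨hF, fun j hj => ?_⟩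
    obtain ⟨N, hN⟩ := hfatou 1 one_pos
    have h1 : MemLp (numberOp^[j] ((u N).1 - F)) 2 μ :=
      ⟨((hsub N).iterate j).measurable.aestronglyMeasurable,
        (hN N le_rfl j hj).trans_lt ENNReal.ofReal_lt_top⟩
    have h2 := ((u N).2.2 j hj).sub h1
    rwa [iterate_sub j (u N).2.1 hF, sub_sub_cancel] at h2
  let G : GenBergman d lam n hlam hn := ⟨F, hFmem⟩
  refine ⟨G, Metric.tendsto_atTop.2 fun ε hε => ?_⟩
  obtain ⟨K, hK, hKb⟩ := exists_norm_sq_le d lam n hlam hn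
  obtain ⟨η, hη, hηε⟩ : ∃ η > 0, K * (M * η) ^ 2 < ε ^ 2 := by
    -- This makes `K (M η)²` equal to `K ε² / (K + 1)`, which is less than `ε²` even when `K = 0`.
    refine ⟨ε / (M * √(K + 1)), by positivity, ?_⟩
    have e : M * (ε / (M * √(K + 1))) = ε / √(K + 1) := by field_simp
    rw [e, div_pow, Real.sq_sqrt (by positivity), ← mul_div_assoc, div_lt_iff₀ (by positivity)]
    nlinarith [pow_pos hε 2]
  obtain ⟨N, hN⟩ := hfatou η hη
  refine ⟨N, fun m hm => ?_⟩
  have h1 := hKb (u m - G) (M * η) (by positivity) fun j hj => hN m hm j hj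
  rw [dist_eq_norm]
  exact (sq_lt_sq₀ (norm_nonneg _) hε.le).1 (h1.trans_lt hηε)

/-! ### The Toeplitz form -/

/-- Point evaluation as a linear functional. -/
def evalAt (z : Cd d) : GenBergman d lam n hlam hn →ₗ[ℂ] ℂ where
  toFun f := f z
  map_add' _ _ := rfl
  map_smul' _ _ := rfl

theorem evalAt_apply (z : Cd d) (f : GenBergman d lam n hlam hn) : evalAt z f = f z := rfl

/-- For `g = ∑ conj(b_i(z)) b_i` both `g(z)` and `‖g‖²` equal the sum `A`, so the point bound
becomes `A² ≤ (1 - |z|²)^(-λ) A`. -/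
theorem norm_sum_le_of_orthonormal (hd : 1 ≤ d) {ι : Type*} (s : Finset ι)
    {b : ι → GenBergman d lam n hlam hn} (hb : Orthonormal ℂ b) {z : Cd d} (hz : z ∈ unitBall d) :
    ∑ i ∈ s, ‖b i z‖ ^ 2 ≤ (1 - ‖z‖ ^ 2) ^ (-lam) := by
  set A := ∑ i ∈ s, ‖b i z‖ ^ 2 with hA
  have hA0 : 0 ≤ A := Finset.sum_nonneg fun i _ => by positivity
  set g : GenBergman d lam n hlam hn := ∑ i ∈ s, conj (b i z) • b i with hg
  have h1 : g z = (A : ℂ) := by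
    rw [← evalAt_apply, hg, map_sum, hA]
    push_cast
    refine Finset.sum_congr rfl fun i _ => ?_
    rw [map_smul, smul_eq_mul, evalAt_apply, Complex.conj_mul']
  have h2 : ‖g‖ ^ 2 = A := by
    rw [← inner_self_eq_norm_sq (𝕜 := ℂ), hg, hb.inner_sum, hA, map_sum]
    refine Finset.sum_congr rfl fun i _ => ?_
    rw [Complex.conj_conj, Complex.mul_conj']
    simp [← Complex.ofReal_pow]
  have h3 := norm_apply_sq_le hd g hz
  rw [h1, h2, Complex.norm_real, Real.norm_of_nonneg hA0, sq] at h3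
  rcases hA0.eq_or_lt with h0 | h0
  · rw [← h0]
    have : 0 < 1 - ‖z‖ ^ 2 := by
      have := mem_unitBall.1 hz
      nlinarith [norm_nonneg z]
    positivity
  · exact le_of_mul_le_mul_right h3 h0

/-- Cauchy–Schwarz over `i`, with the point bound for the `v i` and the kernel bound for the
orthonormal `b i`: each contributes the square root of `(1 - |z|²)^(-λ)`, and the weight cancels
their product. -/
theorem norm_sum_conj_mul_le (hd : 1 ≤ d) {ι : Type*} (s : Finset ι)
    {b v : ι → GenBergman d lam n hlam hn} (hb : Orthonormal ℂ b) (z : Cd d) :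
    ‖∑ i ∈ s, conj (v i z) * b i z‖ * (1 - ‖z‖ ^ 2) ^ lam ≤ √(∑ i ∈ s, ‖v i‖ ^ 2) := by
  by_cases hz : z ∈ unitBall d
  · have hpos : 0 < 1 - ‖z‖ ^ 2 := by
      have := mem_unitBall.1 hz
      nlinarith [norm_nonneg z]
    set K := (1 - ‖z‖ ^ 2) ^ (-lam) with hK
    have hK0 : 0 < K := by positivity
    have hKinv : (1 - ‖z‖ ^ 2) ^ lam = K⁻¹ := by rw [hK, Real.rpow_neg hpos.le, inv_inv]
    set S := ∑ i ∈ s, ‖v i‖ ^ 2 with hS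
    have hS0 : 0 ≤ S := Finset.sum_nonneg fun i _ => by positivity
    have h1 : ∑ i ∈ s, ‖v i z‖ ^ 2 ≤ K * S := by
      rw [hS, Finset.mul_sum]
      exact Finset.sum_le_sum fun i _ => norm_apply_sq_le hd (v i) hz
    have h2 := norm_sum_le_of_orthonormal hd s hb hz
    have h3 : ‖∑ i ∈ s, conj (v i z) * b i z‖ ≤ ∑ i ∈ s, ‖v i z‖ * ‖b i z‖ := by
      refine (norm_sum_le _ _).trans (le_of_eq (Finset.sum_congr rfl fun i _ => ?_))
      rw [norm_mul, RCLike.norm_conj]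
    have h4 := Finset.sum_mul_sq_le_sq_mul_sq s (fun i => ‖v i z‖) fun i => ‖b i z‖
    have h5 : ∑ i ∈ s, ‖v i z‖ * ‖b i z‖ ≤ K * √S := by
      refine (sq_le_sq₀ (Finset.sum_nonneg fun i _ => by positivity) (by positivity)).1 ?_
      rw [mul_pow, Real.sq_sqrt hS0]
      refine h4.trans ?_
      calc _ ≤ K * S * K := by
            gcongr
        _ = _ := by ring
    rw [hKinv, ← div_eq_mul_inv, div_le_iff₀ hK0, mul_comm]
    exact h3.trans h5
  -- Outside the ball the real power has no meaning here, but the functions vanish.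
  · have h : ∀ i, b i z = 0 := fun i => (b i).2.1.2 z hz
    simp only [h, mul_zero, Finset.sum_const_zero, norm_zero, zero_mul]
    positivity

theorem norm_conj_mul_le (hd : 1 ≤ d) (f g : GenBergman d lam n hlam hn) (z : Cd d) :
    ‖f z‖ * ‖g z‖ * (1 - ‖z‖ ^ 2) ^ lam ≤ ‖f‖ * ‖g‖ := by
  by_cases hz : z ∈ unitBall d
  · have hpos : 0 < 1 - ‖z‖ ^ 2 := by
      have := mem_unitBall.1 hz
      nlinarith [norm_nonneg z]
    have h1 := norm_apply_sq_le hd f hz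
    have h2 := norm_apply_sq_le hd g hz
    rw [Real.rpow_neg hpos.le, inv_mul_eq_div, le_div_iff₀ (by positivity)] at h1 h2
    refine (sq_le_sq₀ (by positivity) (by positivity)).1 ?_
    calc _ = (‖f z‖ ^ 2 * (1 - ‖z‖ ^ 2) ^ lam) * (‖g z‖ ^ 2 * (1 - ‖z‖ ^ 2) ^ lam) := by ring
      _ ≤ ‖f‖ ^ 2 * ‖g‖ ^ 2 := by gcongr
      _ = _ := by ring
  · have h : f z = 0 := f.2.1.2 z hz
    rw [h, norm_zero, zero_mul, zero_mul]
    positivity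

theorem norm_toeplitzIntegrand_le (hd : 1 ≤ d) (φ : Cd d → ℂ) (f g : GenBergman d lam n hlam hn)
    (z : Cd d) : ‖toeplitzIntegrand lam φ f g z‖ ≤ ‖f‖ * ‖g‖ * ‖φ z‖ := by
  by_cases hz : z ∈ unitBall d
  · have hpos : 0 < 1 - ‖z‖ ^ 2 := by
      have := mem_unitBall.1 hz
      nlinarith [norm_nonneg z]
    have h := norm_conj_mul_le hd f g z
    rw [toeplitzIntegrand, norm_mul, norm_mul, norm_mul, RCLike.norm_conj, Complex.norm_real,
      Real.norm_of_nonneg (by positivity)]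
    calc _ = ‖f z‖ * ‖g z‖ * (1 - ‖z‖ ^ 2) ^ lam * ‖φ z‖ := by ring
      _ ≤ _ := by gcongr
  · have h : f z = 0 := f.2.1.2 z hz
    rw [toeplitzIntegrand, h, map_zero, zero_mul, zero_mul, zero_mul, norm_zero]
    positivity

theorem integrable_toeplitzIntegrand (hd : 1 ≤ d) {φ : Cd d → ℂ} (hφ : Integrable φ (hypMeasure d))
    (f g : GenBergman d lam n hlam hn) :
    Integrable (toeplitzIntegrand lam φ f g) (hypMeasure d) := by
  have hf : IsHol f := f.2.1
  have hg : IsHol g := g.2.1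
  have hm : AEStronglyMeasurable (toeplitzIntegrand lam φ f g) (hypMeasure d) := by
    have h1 : Measurable fun z => conj (f z) :=
      (RCLike.continuous_conj (K := ℂ)).measurable.comp hf.measurable
    have h2 : Measurable fun z : Cd d => (((1 - ‖z‖ ^ 2) ^ lam : ℝ) : ℂ) := by fun_prop
    exact ((h1.aestronglyMeasurable.mul hφ.1).mul hg.measurable.aestronglyMeasurable).mul
      h2.aestronglyMeasurable
  exact (hφ.norm.const_mul (‖f‖ * ‖g‖)).mono' hm
    (.of_forall fun z => norm_toeplitzIntegrand_le hd φ f g z)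

/-- The sesquilinear form `(f, g) ↦ ∫ conj (f z) φ(z) g(z) (1 - |z|²)^lam dτ(z)`. -/
noncomputable def toeplitzForm (hd : 1 ≤ d) {φ : Cd d → ℂ} (hφ : Integrable φ (hypMeasure d)) :
    GenBergman d lam n hlam hn →L⋆[ℂ] GenBergman d lam n hlam hn →L[ℂ] ℂ :=
  LinearMap.mkContinuous₂
    (LinearMap.mk₂'ₛₗ (starRingEnd ℂ) (RingHom.id ℂ)
      (fun f g : GenBergman d lam n hlam hn => ∫ z, toeplitzIntegrand lam φ f g z ∂(hypMeasure d))
      (fun f f' g => by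
        rw [← integral_add (integrable_toeplitzIntegrand hd hφ f g)
          (integrable_toeplitzIntegrand hd hφ f' g)]
        refine integral_congr_ae (.of_forall fun z => ?_)
        simp only [toeplitzIntegrand, ← evalAt_apply, map_add]
        ring)
      (fun c f g => by
        rw [smul_eq_mul, ← integral_const_mul]
        refine integral_congr_ae (.of_forall fun z => ?_)
        simp only [toeplitzIntegrand, ← evalAt_apply, map_smul, smul_eq_mul, map_mul]
        ring)
      (fun f g g' => by
        rw [← integral_add (integrable_toeplitzIntegrand hd hφ f g)
          (integrable_toeplitzIntegrand hd hφ f g')]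
        refine integral_congr_ae (.of_forall fun z => ?_)
        simp only [toeplitzIntegrand, ← evalAt_apply, map_add]
        ring)
      (fun c f g => by
        rw [RingHom.id_apply, smul_eq_mul, ← integral_const_mul]
        refine integral_congr_ae (.of_forall fun z => ?_)
        simp only [toeplitzIntegrand, ← evalAt_apply, map_smul, smul_eq_mul]
        ring))
    (∫ z, ‖φ z‖ ∂(hypMeasure d)) (fun f g => by
      refine (norm_integral_le_integral_norm _).trans ?_
      refine (integral_mono (integrable_toeplitzIntegrand hd hφ f g).norm
        (hφ.norm.const_mul (‖f‖ * ‖g‖)) fun z => norm_toeplitzIntegrand_le hd φ f g z).trans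
        (le_of_eq ?_)
      rw [integral_const_mul]
      ring)

theorem toeplitzForm_apply (hd : 1 ≤ d) {φ : Cd d → ℂ} (hφ : Integrable φ (hypMeasure d))
    (f g : GenBergman d lam n hlam hn) :
    toeplitzForm hd hφ f g = ∫ z, toeplitzIntegrand lam φ f g z ∂(hypMeasure d) := rfl

/-! ### The Toeplitz operator -/

/-- The Riesz representation puts the operator in the first slot of the inner product; the adjoint
moves it to the second. The entries are correct for all `f` and `g`, not only for bounded ones,
which the Hilbert–Schmidt estimate needs because `T b_i` may be unbounded. -/
theorem exists_toeplitz (hd : 1 ≤ d) {φ : Cd d → ℂ} (hφ : Integrable φ (hypMeasure d)) :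
    ∃ T : GenBergman d lam n hlam hn →L[ℂ] GenBergman d lam n hlam hn, ∀ f g,
      ⟪f, T g⟫_ℂ = (normConst d lam : ℂ) * ∫ z, toeplitzIntegrand lam φ f g z ∂(hypMeasure d) := by
  have := completeSpace_genBergman (hlam := hlam) (hn := hn) hd
  refine ⟨(normConst d lam : ℂ) • ContinuousLinearMap.adjoint
    (InnerProductSpace.continuousLinearMapOfBilin (toeplitzForm hd hφ)), fun f g => ?_⟩
  rw [smul_apply, inner_smul_right, ContinuousLinearMap.adjoint_inner_right,
    InnerProductSpace.continuousLinearMapOfBilin_apply, toeplitzForm_apply]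

/-- With `f = T b_i` and `g = b_i` the formula for the entries expresses the sum `S` as an integral
that is itself controlled by `√S`; the self-improving inequality `S ≤ M √S` gives the claim. -/
theorem sum_norm_sq_toeplitz_le (hd : 1 ≤ d) {φ : Cd d → ℂ} (hφ : Integrable φ (hypMeasure d))
    {T : GenBergman d lam n hlam hn →L[ℂ] GenBergman d lam n hlam hn}
    (hT : ∀ f g, ⟪f, T g⟫_ℂ
      = (normConst d lam : ℂ) * ∫ z, toeplitzIntegrand lam φ f g z ∂(hypMeasure d))
    {ι : Type*} (s : Finset ι) {b : ι → GenBergman d lam n hlam hn} (hb : Orthonormal ℂ b) :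
    ∑ i ∈ s, ‖T (b i)‖ ^ 2 ≤ (|normConst d lam| * ∫ z, ‖φ z‖ ∂(hypMeasure d)) ^ 2 := by
  set M := |normConst d lam| * ∫ z, ‖φ z‖ ∂(hypMeasure d) with hM
  have hM0 : 0 ≤ M := mul_nonneg (abs_nonneg _) (integral_nonneg fun z => norm_nonneg _)
  set S := ∑ i ∈ s, ‖T (b i)‖ ^ 2 with hS
  have hS0 : 0 ≤ S := Finset.sum_nonneg fun i _ => by positivity
  have h1 : (S : ℂ) = (normConst d lam : ℂ) *
      ∫ z, ∑ i ∈ s, toeplitzIntegrand lam φ (T (b i)) (b i) z ∂(hypMeasure d) := by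
    rw [integral_finsetSum _ fun i _ => integrable_toeplitzIntegrand hd hφ _ _, Finset.mul_sum, hS]
    push_cast
    refine Finset.sum_congr rfl fun i _ => ?_
    rw [← hT, inner_self_eq_norm_sq_to_K]
    rfl
  have h2 : ∀ z, ‖∑ i ∈ s, toeplitzIntegrand lam φ (T (b i)) (b i) z‖ ≤ √S * ‖φ z‖ := fun z => by
    have h3 := norm_sum_conj_mul_le hd s (v := fun i => T (b i)) hb z
    have e : ∑ i ∈ s, toeplitzIntegrand lam φ (T (b i)) (b i) z
        = (∑ i ∈ s, conj (T (b i) z) * b i z) * (((1 - ‖z‖ ^ 2) ^ lam : ℝ) : ℂ) * φ z := by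
      rw [Finset.sum_mul, Finset.sum_mul]
      refine Finset.sum_congr rfl fun i _ => ?_
      rw [toeplitzIntegrand]
      ring
    rw [e, norm_mul, norm_mul]
    gcongr
    by_cases hz : z ∈ unitBall d
    · have hpos : 0 < 1 - ‖z‖ ^ 2 := by
        have := mem_unitBall.1 hz
        nlinarith [norm_nonneg z]
      rwa [Complex.norm_real, Real.norm_of_nonneg (by positivity)]
    · have h : ∀ i, b i z = 0 := fun i => (b i).2.1.2 z hz
      simp only [h, mul_zero, Finset.sum_const_zero, norm_zero, zero_mul]
      positivity
  have h4 : S ≤ M * √S := by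
    have h5 := congrArg norm h1
    rw [Complex.norm_real, Real.norm_of_nonneg hS0, norm_mul, Complex.norm_real,
      Real.norm_eq_abs] at h5
    have h6 := norm_integral_le_of_norm_le (hφ.norm.const_mul √S) (.of_forall h2)
    rw [integral_const_mul] at h6
    calc S = _ := h5
      _ ≤ |normConst d lam| * (√S * ∫ z, ‖φ z‖ ∂(hypMeasure d)) := by gcongr
      _ = M * √S := by
        rw [hM]
        ring
  have h5 : √S * √S ≤ M * √S := by rwa [Real.mul_self_sqrt hS0]
  rcases (Real.sqrt_nonneg S).eq_or_lt with h0 | h0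
  · rw [← Real.mul_self_sqrt hS0, ← h0, mul_zero]
    positivity
  · have h6 := le_of_mul_le_mul_right h5 h0
    rw [← Real.sq_sqrt hS0]
    gcongr

theorem hsSum_toeplitz_le (hd : 1 ≤ d) {φ : Cd d → ℂ} (hφ : Integrable φ (hypMeasure d))
    {T : GenBergman d lam n hlam hn →L[ℂ] GenBergman d lam n hlam hn}
    (hT : ∀ f g, ⟪f, T g⟫_ℂ
      = (normConst d lam : ℂ) * ∫ z, toeplitzIntegrand lam φ f g z ∂(hypMeasure d))
    {ι : Type} (b : HilbertBasis ι ℂ (GenBergman d lam n hlam hn)) :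
    hsSum b T ≤ ENNReal.ofReal (|normConst d lam| * ∫ z, ‖φ z‖ ∂(hypMeasure d)) ^ 2 := by
  rw [hsSum, ENNReal.tsum_eq_iSup_sum]
  refine iSup_le fun s => ?_
  have h := sum_norm_sq_toeplitz_le hd hφ hT s b.orthonormal
  have hM0 : 0 ≤ |normConst d lam| * ∫ z, ‖φ z‖ ∂(hypMeasure d) :=
    mul_nonneg (abs_nonneg _) (integral_nonneg fun z => norm_nonneg _)
  rw [← ENNReal.ofReal_pow hM0]
  refine le_trans (le_of_eq ?_) (ENNReal.ofReal_le_ofReal h)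
  rw [ENNReal.ofReal_sum_of_nonneg fun i _ => by positivity]
  refine Finset.sum_congr rfl fun i _ => ?_
  rw [ENNReal.ofReal_pow (norm_nonneg _), ofReal_norm]

/-- Separation by bounded functions is used twice: `S - T` vanishes on bounded functions, hence the
range of its adjoint is orthogonal to all of them and the adjoint is zero. -/
theorem eq_of_hasToeplitzEntries (hd : 1 ≤ d) {φ : Cd d → ℂ}
    {S T : GenBergman d lam n hlam hn →L[ℂ] GenBergman d lam n hlam hn}
    (hS : HasToeplitzEntries φ S) (hT : HasToeplitzEntries φ T) : S = T := by
  have := completeSpace_genBergman (hlam := hlam) (hn := hn) hd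
  have h1 : ∀ g : GenBergman d lam n hlam hn, (∃ C, ∀ z ∈ unitBall d, ‖g z‖ ≤ C) →
      (S - T) g = 0 := fun g hg => by
    refine eq_zero_of_inner_bounded hd _ fun f hf => ?_
    rw [sub_apply, inner_sub_right, hS f g hf hg, hT f g hf hg, sub_self]
  have h2 : ContinuousLinearMap.adjoint (S - T) = 0 := by
    ext1 h
    refine eq_zero_of_inner_bounded hd _ fun g hg => ?_
    rw [ContinuousLinearMap.adjoint_inner_right, h1 g hg, inner_zero_left]
  have h3 : S - T = 0 := by
    rw [← ContinuousLinearMap.adjoint_adjoint (S - T), h2, map_zero]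
  exact sub_eq_zero.1 h3

end Bergman

/-! ### The main theorem -/

theorem mainTheorem4 (d : ℕ) (hd : 1 ≤ d) (lam : ℝ) (hlam : 0 < lam)
    (n : ℕ) (hn : (d : ℝ) < lam + 2 * n)
    (φ : Bergman.Cd d → ℂ) (hφ : Integrable φ (Bergman.hypMeasure d)) :
    (∀ f g : Bergman.GenBergman d lam n hlam hn,
      (∃ C, ∀ z ∈ Bergman.unitBall d, ‖f z‖ ≤ C) → (∃ C, ∀ z ∈ Bergman.unitBall d, ‖g z‖ ≤ C) →
        Integrable (Bergman.toeplitzIntegrand lam φ f g) (Bergman.hypMeasure d)) ∧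
    ∃ T : Bergman.GenBergman d lam n hlam hn →L[ℂ] Bergman.GenBergman d lam n hlam hn,
      (Bergman.IsHilbertSchmidt T ∧ Bergman.HasToeplitzEntries φ T) ∧
      (∀ S : Bergman.GenBergman d lam n hlam hn →L[ℂ] Bergman.GenBergman d lam n hlam hn,
        Bergman.IsHilbertSchmidt S → Bergman.HasToeplitzEntries φ S → S = T) ∧
      Bergman.hsNorm T ≤
        ENNReal.ofReal (|Bergman.normConst d lam| * ∫ z, ‖φ z‖ ∂(Bergman.hypMeasure d)) ∧
      ((∃ k : ℕ, lam = k ∧ k ≤ d) → T = 0) := by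
  refine ⟨fun f g _ _ => Bergman.integrable_toeplitzIntegrand hd hφ f g, ?_⟩
  have := Bergman.completeSpace_genBergman (hlam := hlam) (hn := hn) hd
  obtain ⟨T, hT⟩ := Bergman.exists_toeplitz (hlam := hlam) (hn := hn) hd hφ
  have hent : Bergman.HasToeplitzEntries φ T := fun f g _ _ => hT f g
  refine ⟨T, ⟨?_, hent⟩, fun S _ hS => Bergman.eq_of_hasToeplitzEntries hd hS hent, ?_, ?_⟩
  · obtain ⟨w, b, -⟩ := exists_hilbertBasis ℂ (Bergman.GenBergman d lam n hlam hn)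
    exact ⟨w, b, (Bergman.hsSum_toeplitz_le hd hφ hT b).trans_lt
      (ENNReal.pow_lt_top ENNReal.ofReal_lt_top)⟩
  -- The estimate holds for every orthonormal basis, so the supremum in `hsNorm` needs no
  -- independence of the basis.
  · refine iSup_le fun ι => iSup_le fun b => ?_
    refine (ENNReal.rpow_le_rpow (Bergman.hsSum_toeplitz_le hd hφ hT b) (by norm_num)).trans ?_
    rw [← ENNReal.rpow_natCast, ← ENNReal.rpow_mul]
    norm_num
  · rintro ⟨k, hk, hkd⟩
    -- Here `λ - d = -(d - k)` is a pole of `Γ`, so the constant, and with it every matrix entry,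
    -- vanishes.
    have hc : Bergman.normConst d lam = 0 :=
      Bergman.normConst_eq_zero d lam (d - k) (by rw [hk, Nat.cast_sub hkd]; ring)
    ext1 g
    refine ext_inner_left ℂ fun f => ?_
    rw [hT f g, hc, Complex.ofReal_zero, zero_mul, zero_apply, inner_zero_right]
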